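/- **Setting.** Let $n,k\ge 1$, $N=2^n$, let $D=\langle d_x\rangle_{x\in\{0,1\}^n}$ be a database with $d_x\in\{0,1\}^k$, let $f:\{0,1\}^k\to\{0,1\}$, and put $s=f(D)=\frac1N\sum_x f(d_x)$. Let $T=2^t$, $p\in(0,1)$ and $s_{\min}>0$. Put $O_D|x\rangle|\tau\rangle=|x\rangle|\tau\oplus d_x\rangle$, $U_D(y)=(X^y\otimes I)O_D(X^y\otimes I)$, $U_g|x\rangle|\tau\rangle=(-1)^{g(\tau)}|x\rangle|\tau\rangle$, $U'_f|x\rangle|\tau\rangle|b\rangle=|x\rangle|\tau\rangle|b\oplus f(\tau)\rangle$, $\bar G=(I-2|+\rangle^{\otimes n}\langle+|^{\otimes n})\otimes I$, and $Q_g(y)=\bar G\,U_D(y)\,U_g\,U_D(y)$. **Strategies.** The control qubits are $C_0,\dots,C_{t-1}$, with $C_0$ the most significant. Of the rounds $0,\dots,T-1$, rounds $1,\dots,2^{t-1}$ belong to $C_0$, the next $2^{t-2}$ to $C_1$, and so on; round $0$ belongs to no control qubit. Functions $f_0,\dots,f_{T-1}:\{0,1\}^k\to\{0,1\}$ form a *strategy*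 for computing $f(D)$ if either all $f_i=f$ (trivial strategy), or there is a confusing qubit $C_u$, $u<t-1$, such that, for every $y$: for $w<u$ the product of the $Q_{f_i}(y)$ over the rounds of $C_w$ (in order of application) is $Q_f(y)^{2^{t-w-2}}$; for $C_u$ this product is the identity; and $f_i=f$ in all rounds of the $C_w$ with $w>u$ (nontrivial strategy). **Protocol with honest Alice and Bob.** Alice draws $y\in\{0,1\}^n$ uniformly. Bob prepares two copies of $|+\rangle^{\otimes t}|+\rangle^{\otimes n}|0\rangle^{\otimes k}$ (control, address and data registers), each with an ancilla $|0\rangle$. In round $i=0,\dots,T-1$, on each copy, Alice applies $U_D(y)$, Bob controlled $U_{f_i}$, Alice $U_D(y)$, Bob controlled $\bar G$, where the control is the qubit to which round $i$ belongs (in round $0$ nothing is activated). After the rounds, on each copy Alice applies $U_D(y)$, Bob $U'_f$ and Alice $U_D(y)$. Bob measures the ancilla, performs the quantum Fourier transform on the control qubits (on all of them for the trivial strategy, on all but $C_u$ for a nontrivial one), and measures them, with result $\theta_i$ for copy $i\in\{1,2\}$. He outputs $s_i=\cos^2(\theta_i\pi/T')$, where $T'=T$ for the trivial and $T'=T/2$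 for a nontrivial strategy. **Tests.** In each round, and once in the final stage, Alice draws $r\in(0,1)$ uniformly and tests Bob before the computation of that stage if $r\le p$, after it if $p<r\le 2p$, and not at all otherwise; a failed test terminates the protocol. In a test she draws uniformly $\mu<\nu$ in $\{0,1\}^k$, an address qubit $m$, $x\in\{0,1\}^n$ and $b\in\{0,1\}$, and puts $U_t=\mathrm{SWAP}(0,m)\,Z(x)\,X_0^b\,V\,(H^{\otimes n}\otimes I)$, where $V|a\rangle|\tau\rangle$ is $|a\rangle|\tau\oplus\mu\rangle$ if $a_0=0$ and $|a\rangle|\tau\oplus\nu\rangle$ if $a_0=1$, and $Z(x)$ applies $Z$ to the address qubits $j$ with $x_j=1$. * In round $i$: two copies of $U_t^\dagger U_{f_i}U_t|0\rangle$ are prepared and measured in the computational basis. Bob passes if the two results agree on the first address qubit and are $0$ on all other qubits. * In the final stage: two copies of $U_t^\dagger U'_fU_t|0\rangle|0\rangle$ (with one more ancilla each) are prepared. Bob passes if they pass a controlled swap test and then all address and data qubits except the first address qubits are measured as $0$. **Claim.** Assume that $T>100/\sqrt{s_{\min}}$ if Bob employs the trivial strategy and that $T>200/\sqrt{s_{\min}}$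 if he employs a nontrivial strategy. Then for each $i\in\{1,2\}$, with probability at least $\frac{8}{\pi^2}>0.8$, the protocol is not terminated and $$\begin{cases}\left|\frac{s_i}{s}-1\right|<\frac{2\pi}{100}\sqrt{\frac{s_{\min}}{s}}+\frac{\pi^2}{10^4}\frac{s_{\min}}{s}<0.07, & \text{if } s\ge s_{\min},\\[1ex] \frac{|s_i-s|}{s_{\min}}<\frac{2\pi}{100}\sqrt{\frac{s}{s_{\min}}}+\frac{\pi^2}{10^4}<0.07, & \text{if } s<s_{\min}.\end{cases}$$ -/

import Mathlib

open scoped Kronecker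

noncomputable section

namespace QCount

/-! ### Registers, gates and measurement weights

Qubit registers are indexed by bit strings; bits are elements of `ZMod 2`, so that `+` is XOR.
A state is a vector of amplitudes over the computational basis. -/

/-- Bit strings of length `m`. -/
abbrev Bits (m : ℕ) : Type := Fin m → ZMod 2

/-- The integer represented in binary by the positions `w ∈ M` of a bit string, read in increasing
order of `w` with the most significant bit first. -/
def binVal {m : ℕ} (M : Finset (Fin m)) (c : Bits m) : ℕ :=
  ∑ w ∈ M, (c w).val * 2 ^ (M.filter (fun v => w < v)).card

/-- The gate `|j⟩ ↦ |σ j⟩`. -/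
def permGate {ι : Type} [DecidableEq ι] (σ : ι → ι) : Matrix ι ι ℂ :=
  Matrix.of fun i j => if i = σ j then 1 else 0

/-- The basis vector `|i⟩`. -/
def ket {ι : Type} [DecidableEq ι] (i : ι) : ι → ℂ := Pi.single i 1

/-- The state `|+⟩^{⊗ m}`. -/
def plusKet (m : ℕ) : Bits m → ℂ := fun _ => ((√(2 ^ m : ℝ) : ℝ) : ℂ)⁻¹

/-- The Hadamard gate on one qubit. -/
def hGate : Matrix (ZMod 2) (ZMod 2) ℂ :=
  Matrix.of fun a b => ((√2 : ℝ) : ℂ)⁻¹ * (-1) ^ (a.val * b.val)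

/-- `W = H^{⊗ m}`. -/
def hadamard (m : ℕ) : Matrix (Bits m) (Bits m) ℂ :=
  Matrix.of fun a b => ∏ j, hGate (a j) (b j)

/-- The quantum Fourier transform (modulo `2 ^ #M`) on the qubits in `M`, the other qubits of the
register being left alone. -/
def qft {t : ℕ} (M : Finset (Fin t)) : Matrix (Bits t) (Bits t) ℂ :=
  Matrix.of fun c' c =>
    if ∀ w, w ∉ M → c' w = c w then
      ((√(2 ^ M.card : ℝ) : ℝ) : ℂ)⁻¹ *
        Complex.exp (2 * Real.pi * Complex.I * (binVal M c) * (binVal M c') / 2 ^ M.card)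
    else 0

/-! ### The database and the operators of the two parties -/

/-- Basis of the address and data registers `q_a, q_d`. -/
abbrev AD (n k : ℕ) : Type := Bits n × Bits k

/-- A database with `N = 2 ^ n` transactions `d_x ∈ {0,1}^k`, indexed by their addresses. -/
abbrev Database (n k : ℕ) : Type := Bits n → Bits k

/-- `f(D) = (1/N) ∑_j f(d_j)`. -/
def frac {n k : ℕ} (D : Database n k) (f : Bits k → ZMod 2) : ℝ :=
  1 / 2 ^ n * ∑ x, ((f (D x)).val : ℝ)

/-- The quantum database `O_D |x⟩|τ⟩ = |x⟩|τ ⊕ d_x⟩`. -/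
def oracle {n k : ℕ} (D : Database n k) : Matrix (AD n k) (AD n k) ℂ :=
  permGate fun s => (s.1, s.2 + D s.1)

/-- `X^y ⊗ I_d`. -/
def shiftX {n k : ℕ} (y : Bits n) : Matrix (AD n k) (AD n k) ℂ :=
  permGate fun s => (s.1 + y, s.2)

/-- Alice's operator `U_D(y) = (X^y ⊗ I_d) O_D (X^y ⊗ I_d)`. -/
def UD {n k : ℕ} (D : Database n k) (y : Bits n) : Matrix (AD n k) (AD n k) ℂ :=
  shiftX y * oracle D * shiftX y

/-- Bob's operator `U_f |j⟩|τ⟩ = (-1)^{f(τ)} |j⟩|τ⟩`. -/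
def Uf (n : ℕ) {k : ℕ} (f : Bits k → ZMod 2) : Matrix (AD n k) (AD n k) ℂ :=
  Matrix.diagonal fun s => (-1) ^ (f s.2).val

/-- `Ḡ = G ⊗ I_d` with `G = I - 2 |+⟩^{⊗ n}⟨+|^{⊗ n}`. -/
def Gbar (n k : ℕ) : Matrix (AD n k) (AD n k) ℂ :=
  (1 - (2 : ℂ) • Matrix.vecMulVec (plusKet n) (star (plusKet n))) ⊗ₖ (1 : Matrix (Bits k) (Bits k) ℂ)

/-- One uncontrolled iteration `Ḡ U_D(y) U_g U_D(y)`. -/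
def iter {n k : ℕ} (D : Database n k) (y : Bits n) (g : Bits k → ZMod 2) :
    Matrix (AD n k) (AD n k) ℂ :=
  Gbar n k * UD D y * Uf n g * UD D y

/-! ### Bob's strategies -/

/-- Round `i` belongs to the control qubit `C_w`: the rounds `1, …, 2^{t-1}` belong to `C_0`, the
next `2^{t-2}` rounds to `C_1`, and so on; round `0` belongs to no control qubit. -/
def InBlock {t : ℕ} (w : Fin t) (i : ℕ) : Prop :=
  2 ^ t - 2 ^ (t - w.val) < i ∧ i ≤ 2 ^ t - 2 ^ (t - w.val - 1)

instance {t : ℕ} (w : Fin t) (i : ℕ) : Decidable (InBlock w i) := by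
  unfold InBlock; infer_instance

/-- The effect of `L` successive iterations with the functions `g 0, …, g (L-1)`. -/
def effect {n k : ℕ} (D : Database n k) (y : Bits n) (g : ℕ → Bits k → ZMod 2) :
    ℕ → Matrix (AD n k) (AD n k) ℂ
  | 0 => 1
  | L + 1 => iter D y (g L) * effect D y g L

/-- The effect of the `2^{t-w-1}` iterations that belong to the control qubit `C_w`. -/
def blockEffect {n k t : ℕ} (D : Database n k) (y : Bits n) (fs : ℕ → Bits k → ZMod 2)
    (w : Fin t) : Matrix (AD n k) (AD n k) ℂ :=
  effect D y (fun l => fs (2 ^ t - 2 ^ (t - w.val) + 1 + l)) (2 ^ (t - w.val - 1))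

/-- `f_0, …, f_{T-1}` (`T = 2 ^ t`) is a strategy for computing `f(D)`: the trivial one (`none`),
or one with confusing qubit `C_u` (`some u`). In the second case noise is added to the functions of
`C_0, …, C_u` only, the functions of `C_u` have the effect of the identity, and for `w < u` half of
the `2^{t-w-1}` iterations of `C_w` cancel, so that their effect is that of `2^{t-w-2}` repetitions
of `f`. -/
def IsStrategy {n k t : ℕ} (D : Database n k) (f : Bits k → ZMod 2)
    (fs : ℕ → Bits k → ZMod 2) : Option (Fin t) → Prop
  | none => ∀ i, i < 2 ^ t → fs i = f
  | some u => u.val + 1 < t ∧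
      (∀ w : Fin t, w < u → ∀ y, blockEffect D y fs w = iter D y f ^ 2 ^ (t - w.val - 2)) ∧
      (∀ y, blockEffect D y fs u = 1) ∧
      (∀ w : Fin t, u < w → ∀ i, InBlock w i → fs i = f)

/-- The control qubits to which the final Fourier transform and measurement are applied: all of
them, except the confusing qubit if there is one. -/
def readQubits {t : ℕ} : Option (Fin t) → Finset (Fin t)
  | none => Finset.univ
  | some u => Finset.univ.erase u

/-! ### The computational states -/

/-- Basis of one copy of the registers: address and data `q_a, q_d`, control `q_c`, ancilla
`q_g`. -/
abbrev Copy (n k t : ℕ) : Type := (AD n k × Bits t) × ZMod 2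

/-- Basis of the two copies together. -/
abbrev Joint (n k t : ℕ) : Type := Copy n k t × Copy n k t

/-- Apply `A` on `q_a, q_d`. -/
def onAD {n k : ℕ} (t : ℕ) (A : Matrix (AD n k) (AD n k) ℂ) :
    Matrix (Copy n k t) (Copy n k t) ℂ :=
  Matrix.blockDiagonal fun _ => Matrix.blockDiagonal fun _ => A

/-- Controlled `A` in round `i`: `A` is activated iff round `i` belongs to a control qubit and this
control qubit is in state `|1⟩`. -/
def controlled {n k : ℕ} (t i : ℕ) (A : Matrix (AD n k) (AD n k) ℂ) :
    Matrix (Copy n k t) (Copy n k t) ℂ :=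
  Matrix.blockDiagonal fun _ => Matrix.blockDiagonal fun c : Bits t =>
    if ∃ w, InBlock w i ∧ c w = 1 then A else 1

/-- `U'_f |j⟩|τ⟩|g⟩ = |j⟩|τ⟩|g ⊕ f(τ)⟩` on `q_a, q_d, q_g`. -/
def Uf' (n : ℕ) {k : ℕ} (t : ℕ) (f : Bits k → ZMod 2) : Matrix (Copy n k t) (Copy n k t) ℂ :=
  permGate fun s => (s.1, s.2 + f s.1.1.2)

/-- Fourier transform on the qubits `M` of `q_c`. -/
def fourier (n k : ℕ) {t : ℕ} (M : Finset (Fin t)) : Matrix (Copy n k t) (Copy n k t) ℂ :=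
  ((1 : Matrix (AD n k) (AD n k) ℂ) ⊗ₖ qft M) ⊗ₖ (1 : Matrix (ZMod 2) (ZMod 2) ℂ)

/-- Apply `A` on the first copy. -/
def onFst {n k t : ℕ} (A : Matrix (Copy n k t) (Copy n k t) ℂ) :
    Matrix (Joint n k t) (Joint n k t) ℂ := A ⊗ₖ 1

/-- Apply `A` on the second copy. -/
def onSnd {n k t : ℕ} (A : Matrix (Copy n k t) (Copy n k t) ℂ) :
    Matrix (Joint n k t) (Joint n k t) ℂ := 1 ⊗ₖ A

/-- Bob's initial state `|+⟩^{⊗ t} |+⟩^{⊗ n} |0⟩` of one copy, with the ancilla in `|0⟩`. -/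
def initCopy (n k t : ℕ) : Copy n k t → ℂ := fun s =>
  plusKet n s.1.1.1 * ket (0 : Bits k) s.1.1.2 * plusKet t s.1.2 * ket (0 : ZMod 2) s.2

/-- Procedure GroverIteration(`i`) on the two copies. -/
def groverRound {n k : ℕ} (t : ℕ) (D : Database n k) (y : Bits n) (g : Bits k → ZMod 2) (i : ℕ) :
    Matrix (Joint n k t) (Joint n k t) ℂ :=
  let A := controlled t i (Uf n g) * onAD t (UD D y)
  let B := controlled t i (Gbar n k) * onAD t (UD D y)
  onSnd B * onFst B * onSnd A * onFst A

/-- The state of the two copies after the rounds `0, …, i-1`. -/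
def stateAfter {n k : ℕ} (t : ℕ) (D : Database n k) (y : Bits n) (fs : ℕ → Bits k → ZMod 2) :
    ℕ → Joint n k t → ℂ
  | 0 => fun s => initCopy n k t s.1 * initCopy n k t s.2
  | i + 1 => (groverRound t D y (fs i) i).mulVec (stateAfter t D y fs i)

/-- The state right before the final measurements: after the `T = 2 ^ t` rounds, Alice applies
`U_D(y)` and Bob `U'_f` on each copy, Alice applies `U_D(y)` on each copy, and Bob performs the
Fourier transform on the control qubits `M` of each copy. -/
def finalState {n k t : ℕ} (D : Database n k) (y : Bits n) (f : Bits k → ZMod 2)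
    (fs : ℕ → Bits k → ZMod 2) (M : Finset (Fin t)) : Joint n k t → ℂ :=
  let A := Uf' n t f * onAD t (UD D y)
  let U : Matrix (Copy n k t) (Copy n k t) ℂ := onAD t (UD D y)
  let F := fourier n k M
  (onSnd F * onFst F * onSnd U * onFst U * onSnd A * onFst A).mulVec (stateAfter t D y fs (2 ^ t))

/-- Bob's estimate `cos²(θ π / 2^{#M})` from the outcome `θ ∈ {0, …, 2^{#M} - 1}` of the measurement
of the control qubits `M`. The iteration `Ḡ U_D U_f U_D` with `G = I - 2|+⟩⟨+|` has the eigenvalues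
`-exp(± 2 i φ)`, `sin² φ = f(D)`, on the relevant plane, so the estimate is the same function of `θ`
for both outcomes of the measurement of the ancilla. -/
def estimate {n k t : ℕ} (M : Finset (Fin t)) (s : Copy n k t) : ℝ :=
  Real.cos (binVal M s.1.2 * Real.pi / 2 ^ M.card) ^ 2

/-! ### Alice's tests -/

/-- The random data `(μ < ν), m, x, b` of a test. (The random string on the control register of a
test state is not touched by any operation and is left out.) -/
abbrev TestData (n k : ℕ) : Type :=
  {q : Bits k × Bits k // binVal Finset.univ q.1 < binVal Finset.univ q.2} ×
    Fin n × Bits n × ZMod 2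

/-- `U_t = SWAP(0,m) Z(x) X_0^b V(μ,ν) (W ⊗ I_d)`. -/
def Ut {n k : ℕ} [NeZero n] (d : TestData n k) : Matrix (AD n k) (AD n k) ℂ :=
  let swapGate : Matrix (AD n k) (AD n k) ℂ := permGate fun s => (s.1 ∘ Equiv.swap 0 d.2.1, s.2)
  let zGate : Matrix (AD n k) (AD n k) ℂ :=
    Matrix.diagonal fun s => ∏ j, (-1) ^ ((d.2.2.1 j).val * (s.1 j).val)
  let xGate : Matrix (AD n k) (AD n k) ℂ := permGate fun s => (s.1 + Pi.single 0 d.2.2.2, s.2)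
  let V : Matrix (AD n k) (AD n k) ℂ :=
    permGate fun s => (s.1, s.2 + if s.1 0 = 0 then d.1.1.1 else d.1.1.2)
  swapGate * zGate * xGate * V * (hadamard n ⊗ₖ (1 : Matrix (Bits k) (Bits k) ℂ))

open Classical in
/-- Probability that honest Bob passes TestBob1 in a round with function `g`: the state `Φ` is
prepared twice, both are measured, and the outcomes `v, w` must agree on the first address qubit and
vanish on all other qubits. -/
def passTest1 (n : ℕ) {k : ℕ} [NeZero n] (g : Bits k → ZMod 2) : ℝ :=
  (∑ d : TestData n k,
    let Φ := ((Ut d).conjTranspose * Uf n g * Ut d).mulVec (ket (0, 0))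
    ∑ v : AD n k, ∑ w : AD n k,
      if v.1 0 = w.1 0 ∧ (∀ j, j ≠ 0 → v.1 j = 0 ∧ w.1 j = 0) ∧ v.2 = 0 ∧ w.2 = 0
      then ‖Φ v‖ ^ 2 * ‖Φ w‖ ^ 2 else 0) / Fintype.card (TestData n k)

open Classical in
/-- Probability that honest Bob passes TestBob2: two copies of `Φ` (on `q_a, q_d, q_g`) go through a
controlled swap test, where the outcome of the control qubit must be `0`, and all address and data
qubits except the first address qubits must be measured as `0`. -/
def passTest2 (n : ℕ) {k : ℕ} [NeZero n] (f : Bits k → ZMod 2) : ℝ :=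
  (∑ d : TestData n k,
    let S := AD n k × ZMod 2
    let U : Matrix S S ℂ := Ut d ⊗ₖ (1 : Matrix (ZMod 2) (ZMod 2) ℂ)
    let U' : Matrix S S ℂ := permGate fun s => (s.1, s.2 + f s.1.2)
    let Φ : S → ℂ := (U.conjTranspose * U' * U).mulVec (ket ((0, 0), 0))
    let cswap : Matrix (ZMod 2 × S × S) (ZMod 2 × S × S) ℂ :=
      permGate fun s => if s.1 = 1 then (s.1, s.2.2, s.2.1) else s
    let start : ZMod 2 × S × S → ℂ := fun s => ((√2 : ℝ) : ℂ)⁻¹ * Φ s.2.1 * Φ s.2.2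
    let Ψ := ((hGate ⊗ₖ (1 : Matrix (S × S) (S × S) ℂ)) * cswap).mulVec start
    ∑ v : S, ∑ w : S,
      if (∀ j, j ≠ 0 → v.1.1 j = 0 ∧ w.1.1 j = 0) ∧ v.1.2 = 0 ∧ w.1.2 = 0
      then ‖Ψ (0, v, w)‖ ^ 2 else 0) / Fintype.card (TestData n k)

/-- Probability that a stage of the protocol is not terminated: Alice draws `r ∈ (0,1)` uniformly;
if `r ≤ p` she tests before the computational round, if `p < r ≤ 2p` after it (each test is passed
with probability `q`), otherwise not at all. -/
def survive (p q : ℝ) : ℝ :=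
  ∫ r in (0 : ℝ)..1, if r ≤ p then q else if r ≤ 2 * p then q else 1

/-! ### The protocol with honest parties -/

open Classical in
/-- Probability that the protocol run by honest parties is not terminated by a test and that its
output `(s_1, s_2)` (here `s 0` and `s 1`) satisfies `E`. Alice's `y` is uniform; the tests act on
fresh registers and do not touch the computational states; the outputs are functions of the results
of measuring the final state in the computational basis. -/
def protocolProb {n k t : ℕ} [NeZero n] (p : ℝ) (D : Database n k) (f : Bits k → ZMod 2)
    (fs : ℕ → Bits k → ZMod 2) (conf : Option (Fin t)) (E : (Fin 2 → ℝ) → Prop) : ℝ :=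
  1 / 2 ^ n * ∑ y : Bits n,
    (∏ i ∈ Finset.range (2 ^ t), survive p (passTest1 n (fs i))) * survive p (passTest2 n f) *
      ∑ s : Joint n k t,
        if E ![estimate (readQubits conf) s.1, estimate (readQubits conf) s.2]
        then ‖finalState D y f fs (readQubits conf) s‖ ^ 2 else 0

end QCount

end

open QCount

namespace QCount

noncomputable section

/-! ### Phase estimation -/

/-! The protocol is phase estimation of the Grover iteration, masked by Alice's shift and
interleaved with tests that an honest Bob never fails.

The tests drop out first. The preparation `testPrep` commutes with Bob's gate up to replacing the
data by one of two strings selected by the first address qubit. A test therefore only involves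
`f(μ)` and `f(ν)`, and both pass probabilities are exactly 1 (`passTest1_eq_one`,
`passTest2_eq_one`).

In the computation the mask `y` merely translates the database. The two copies never interact, so
the state remains a product (`stateAfter_eq`, `finalState_eq`). With the control register in `|c⟩`,
the rounds apply the power of the iteration encoded by the measured control bits
(`IsStrategy.roundsEffect_eq`). A confusing qubit contributes the identity, and the weights of the
more significant bits are halved, so removing it leaves ordinary phase estimation with one qubit
fewer.

With `sin² φ = f(D)`, the powers of the iteration on the start state have a closed form in odd
multiples of `φ` (`iter_pow_mulVec`). Combining the sine and cosine parts as `B ± iA` splits the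
outcome distribution into the equal mixture of those for the phases `π ± 2φ` (`sum_norm_phase_sum`).
For either phase the two neighbouring outcomes have total probability at least `8/π²`
(`eight_div_pi_sq_le_sum_dirichlet`), hence so does the mixture. For these outcomes the angle error
is at most `π/T'`, where `T'` is the number of outcomes. Trigonometry turns it into an error of the
estimate (`abs_cos_sq_sub_sin_sq_le`), and the assumption on `T` gives the stated bounds
(`error_bounds`). Parseval's identity makes the other copy integrate to 1 (`sum_norm_copyFinal`). -/

theorem sq_one_sub_sq_le_cos_sq_mul {u : ℝ} (h0 : 0 ≤ u) (h1 : u ≤ 1) :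
    (1 - u ^ 2) ^ 2 ≤ Real.cos (Real.pi * u / 2) ^ 2 * (1 + u ^ 2) := by
  have hpi := Real.pi_gt_d2
  have hpi' := Real.pi_lt_d2
  rcases le_total u (3 / 5) with h | h
  -- Away from `u = 1` the quadratic bound `cos x ≥ 1 - x²/2` suffices; 1.2404 is an upper bound for
  -- `π²/8`. Near `u = 1`, where the cosine vanishes, the cubic lower bound for the sine takes over.
  · have hc := Real.one_sub_sq_div_two_le_cos (x := Real.pi * u / 2)
    have hv : u ^ 2 ≤ 9 / 25 := by nlinarith
    have hv0 : 0 ≤ u ^ 2 := sq_nonneg u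
    have hp : Real.pi ^ 2 ≤ 9.9225 := by nlinarith
    have h2 : 1 - 1.2404 * u ^ 2 ≤ Real.cos (Real.pi * u / 2) := by
      refine le_trans ?_ hc
      nlinarith
    have h3 : (1 - 1.2404 * u ^ 2) ^ 2 ≤ Real.cos (Real.pi * u / 2) ^ 2 :=
      pow_le_pow_left₀ (by nlinarith) h2 2
    have h4 : (1 - u ^ 2) ^ 2 ≤ (1 - 1.2404 * u ^ 2) ^ 2 * (1 + u ^ 2) := by
      generalize u ^ 2 = v at hv hv0
      have : 0 ≤ v * (0.5192 - 1.9422 * v + 1.5385 * v ^ 2) := by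
        refine mul_nonneg hv0 ?_
        nlinarith
      nlinarith [pow_nonneg hv0 3, pow_nonneg hv0 2]
    exact h4.trans (mul_le_mul_of_nonneg_right h3 (by positivity))
  · obtain ⟨z, rfl⟩ : ∃ z, u = 1 - z := ⟨1 - u, by ring⟩
    have hz0 : 0 ≤ z := by linarith
    have hz : z ≤ 2 / 5 := by linarith
    rcases hz0.eq_or_lt with rfl | hz0
    · norm_num
    have hcos : Real.cos (Real.pi * (1 - z) / 2) = Real.sin (Real.pi * z / 2) := by
      rw [← Real.cos_pi_div_two_sub]; congr 1; ring
    have hs := (Real.sin_gt_sub_cube (x := Real.pi * z / 2) (by positivity)).le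
    rw [hcos]
    have hy : (Real.pi * z / 2) ^ 2 ≤ 0.4 := by
      have : Real.pi * z / 2 ≤ 0.63 := by nlinarith
      have h0 : 0 ≤ Real.pi * z / 2 := by positivity
      nlinarith
    have h2 : 1.45 * z ≤ Real.sin (Real.pi * z / 2) := by
      refine le_trans ?_ hs
      have : 0 ≤ Real.pi * z / 2 * (0.4 / 6 - (Real.pi * z / 2) ^ 2 / 6) :=
        mul_nonneg (by positivity) (by linarith)
      nlinarith
    have h3 : (1.45 * z) ^ 2 ≤ Real.sin (Real.pi * z / 2) ^ 2 :=
      pow_le_pow_left₀ (by positivity) h2 2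
    have h4 : (1 - (1 - z) ^ 2) ^ 2 ≤ (1.45 * z) ^ 2 * (1 + (1 - z) ^ 2) := by
      -- Here `(2 - z)² = (1 + (1 - z))²`, which is at most twice the sum of squares; the factor 2.1
      -- stays below `1.45²`.
      have : (2 - z) ^ 2 ≤ 2.1 * (1 + (1 - z) ^ 2) := by nlinarith
      have := mul_le_mul_of_nonneg_left this (sq_nonneg z)
      nlinarith [mul_nonneg (sq_nonneg z) (add_nonneg zero_le_one (sq_nonneg (1 - z)))]
    exact h4.trans (mul_le_mul_of_nonneg_right h3 (by positivity))

/-- Centring at the midpoint with `u = 2e - 1` gives `1/e² + 1/(1-e)² = 8(1+u²)/(1-u²)²` and `sin πe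
= cos(πu/2)`, so this is the preceding inequality. Equality occurs for a phase midway between two
outcomes. -/
theorem eight_le_sin_sq_mul {e : ℝ} (h0 : 0 < e) (h1 : e < 1) :
    8 ≤ Real.sin (Real.pi * e) ^ 2 / e ^ 2 + Real.sin (Real.pi * (1 - e)) ^ 2 / (1 - e) ^ 2 := by
  have hs : Real.sin (Real.pi * (1 - e)) = Real.sin (Real.pi * e) := by
    rw [← Real.sin_pi_sub]; congr 1; ring
  have hc : Real.sin (Real.pi * e) = Real.cos (Real.pi * |2 * e - 1| / 2) := by
    have : Real.cos (Real.pi * |2 * e - 1| / 2) = Real.cos (Real.pi * (2 * e - 1) / 2) := by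
      rcases abs_choice (2 * e - 1) with h | h <;> rw [h]
      rw [← Real.cos_neg]; congr 1; ring
    rw [this, ← Real.cos_pi_div_two_sub, ← Real.cos_neg]; congr 1; ring
  have := sq_one_sub_sq_le_cos_sq_mul (abs_nonneg (2 * e - 1))
    (abs_le.2 ⟨by linarith, by linarith⟩)
  rw [← hc, sq_abs] at this
  have he : 0 < 1 - e := by linarith
  rw [hs, div_add_div _ _ (by positivity) (by positivity), le_div_iff₀ (by positivity)]
  nlinarith

/-- The amplitude of the outcome of phase estimation at phase distance `α`. -/
def dirichlet (T : ℕ) (α : ℝ) : ℂ :=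
  (T : ℂ)⁻¹ * ∑ m ∈ Finset.range T, Complex.exp (Complex.I * α) ^ m

theorem dirichlet_add_two_pi (T : ℕ) (α : ℝ) (j : ℤ) :
    dirichlet T (α + 2 * Real.pi * j) = dirichlet T α := by
  unfold dirichlet
  congr 3
  have : Complex.I * ((α + 2 * Real.pi * j : ℝ) : ℂ) =
      Complex.I * α + j * (2 * Real.pi * Complex.I) := by push_cast; ring
  rw [this, Complex.exp_add, Complex.exp_int_mul_two_pi_mul_I, mul_one]

/-- Summing the geometric series gives the ratio of `|sin πe|` to `T |sin(πe/T)|`, and `|sin x| ≤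
|x|` bounds the denominator. The product form avoids division at `e = 0`. -/
theorem sin_sq_le_norm_dirichlet {T : ℕ} (hT : 0 < T) (e : ℝ) :
    Real.sin (Real.pi * e) ^ 2 ≤
      ‖dirichlet T (2 * Real.pi * e / T)‖ ^ 2 * (Real.pi ^ 2 * e ^ 2) := by
  have hT' : (0 : ℝ) < T := by exact_mod_cast hT
  set α : ℝ := 2 * Real.pi * e / T with hα
  have hg := geom_sum_mul (Complex.exp (Complex.I * α)) T
  have hn := congrArg norm hg
  have h2 : Complex.exp (Complex.I * α) ^ T = Complex.exp (Complex.I * ((T * α : ℝ) : ℂ)) := by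
    rw [← Complex.exp_nat_mul]; congr 1; push_cast; ring
  rw [norm_mul, h2, Complex.norm_exp_I_mul_ofReal_sub_one,
    Complex.norm_exp_I_mul_ofReal_sub_one] at hn
  have h3 : T * α / 2 = Real.pi * e := by rw [hα]; field_simp
  rw [h3, norm_mul, norm_mul, Real.norm_eq_abs, Real.norm_eq_abs, Real.norm_eq_abs] at hn
  have h4 : |Real.sin (α / 2)| ≤ |α / 2| := Real.abs_sin_le_abs
  have h5 : |Real.sin (Real.pi * e)| ≤
      ‖∑ m ∈ Finset.range T, Complex.exp (Complex.I * α) ^ m‖ * |α / 2| := by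
    have := mul_le_mul_of_nonneg_left h4
      (norm_nonneg (∑ m ∈ Finset.range T, Complex.exp (Complex.I * α) ^ m))
    have h22 : |(2 : ℝ)| = 2 := by norm_num
    rw [h22] at hn
    linarith
  have h6 : ‖dirichlet T α‖ = (T : ℝ)⁻¹ *
      ‖∑ m ∈ Finset.range T, Complex.exp (Complex.I * α) ^ m‖ := by
    unfold dirichlet; rw [norm_mul, norm_inv, Complex.norm_natCast]
  have h7 := pow_le_pow_left₀ (abs_nonneg _) h5 2
  rw [sq_abs, mul_pow, sq_abs] at h7
  refine h7.trans_eq ?_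
  rw [h6, hα]; field_simp

theorem dirichlet_zero {T : ℕ} (hT : 0 < T) : dirichlet T 0 = 1 := by
  have : (T : ℂ) ≠ 0 := by exact_mod_cast hT.ne'
  simp [dirichlet, this]

/-- Phase estimation: with probability at least `8 / π²` the outcome is one of the two multiples
of `1 / T` next to the phase. -/
theorem eight_div_pi_sq_le_sum_dirichlet {T : ℕ} (hT : 0 < T) (β : ℝ) (E : ℕ → Prop)
    [DecidablePred E]
    (hE : ∀ θ : ℕ, ∀ j : ℤ, |2 * Real.pi * θ / T + β - 2 * Real.pi * j| ≤ 2 * Real.pi / T → E θ) :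
    8 / Real.pi ^ 2 ≤ ∑ θ ∈ Finset.range T,
      if E θ then ‖dirichlet T (2 * Real.pi * θ / T + β)‖ ^ 2 else 0 := by
  have hpi := Real.pi_gt_d2
  have h8 : 8 / Real.pi ^ 2 ≤ 1 := by rw [div_le_one (by positivity)]; nlinarith
  have hT' : (0 : ℝ) < T := by exact_mod_cast hT
  have hTz : (0 : ℤ) < T := by exact_mod_cast hT
  -- The distribution peaks where `θ ≡ x` modulo `T`, so the useful outcomes are the residues of
  -- `⌊x⌋` and `⌊x⌋ + 1`.
  set x : ℝ := -β * T / (2 * Real.pi) with hx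
  have hβ : β = -(2 * Real.pi * x / T) := by rw [hx]; field_simp
  -- the outcome next to an integer `a`
  have key : ∀ a : ℤ, |a - x| ≤ 1 → ∃ θ : ℕ, θ < T ∧ (θ : ℤ) = a % T ∧ E θ ∧
      dirichlet T (2 * Real.pi * θ / T + β) = dirichlet T (2 * Real.pi * (a - x) / T) := by
    intro a ha
    have hθ : (((a % T).toNat : ℕ) : ℤ) = a % T := Int.toNat_of_nonneg (Int.emod_nonneg _ hTz.ne')
    have hr : (((a % T).toNat : ℕ) : ℝ) = a - T * (a / T : ℤ) := by
      have : ((((a % T).toNat : ℕ) : ℤ) : ℝ) = ((a - T * (a / T) : ℤ) : ℝ) := by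
        rw [hθ, Int.emod_def]
      push_cast at this ⊢
      exact this
    have hph : 2 * Real.pi * ((a % T).toNat : ℕ) / T + β =
        2 * Real.pi * (a - x) / T + 2 * Real.pi * ((-(a / T) : ℤ) : ℝ) := by
      rw [hr, hβ]; push_cast; field_simp; ring
    refine ⟨(a % T).toNat, ?_, hθ, hE _ (-(a / T)) ?_, ?_⟩
    · have := Int.emod_lt_of_pos a hTz
      omega
    · rw [hph, add_sub_cancel_right, mul_div_assoc, abs_mul, abs_div, abs_of_pos hT',
        abs_of_pos (by positivity : 0 < 2 * Real.pi), mul_div_assoc' ]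
      exact div_le_div_of_nonneg_right (mul_le_of_le_one_right (by positivity) ha) hT'.le
    · rw [hph, dirichlet_add_two_pi]
  have nn : ∀ θ ∈ Finset.range T, 0 ≤
      if E θ then ‖dirichlet T (2 * Real.pi * θ / T + β)‖ ^ 2 else 0 := by
    intro θ _; split_ifs <;> positivity
  have hfl := Int.floor_le x
  have hfl' := Int.lt_floor_add_one x
  obtain ⟨θ₀, hθ₀, hm₀, hE₀, hd₀⟩ := key ⌊x⌋ (abs_le.2 ⟨by linarith, by linarith⟩)
  obtain ⟨θ₁, hθ₁, hm₁, hE₁, hd₁⟩ := key (⌊x⌋ + 1)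
    (abs_le.2 ⟨by push_cast; linarith, by push_cast; linarith⟩)
  by_cases hone : (⌊x⌋ : ℝ) = x
  · refine h8.trans ?_
    have := Finset.single_le_sum nn (Finset.mem_range.2 hθ₀)
    rw [if_pos hE₀, hd₀, hone] at this
    simpa [dirichlet_zero hT] using this
  -- For `T ≥ 2` the two neighbours are distinct residues and their weights add. For `T = 1` they
  -- coincide, but the only outcome is certain.
  rcases Nat.lt_or_ge 1 T with hT2 | hT1
  · have hne : θ₀ ≠ θ₁ := by
      intro h
      have h1 : ⌊x⌋ % (T : ℤ) = (⌊x⌋ + 1) % T := by rw [← hm₀, ← hm₁, h]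
      have h2 : (T : ℤ) ∣ ⌊x⌋ + 1 - ⌊x⌋ := Int.ModEq.dvd h1
      rw [add_sub_cancel_left] at h2
      have := Int.le_of_dvd one_pos h2
      omega
    have hsub : ({θ₀, θ₁} : Finset ℕ) ⊆ Finset.range T := by
      intro z hz
      simp only [Finset.mem_insert, Finset.mem_singleton] at hz
      rcases hz with rfl | rfl <;> simpa
    have := Finset.sum_le_sum_of_subset_of_nonneg hsub (fun i hi _ => nn i hi)
    rw [Finset.sum_pair hne, if_pos hE₀, if_pos hE₁, hd₀, hd₁] at this
    refine le_trans ?_ this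
    set e : ℝ := x - ⌊x⌋ with he
    have he0 : 0 < e := by
      rcases hfl.eq_or_lt with h | h
      · exact absurd h hone
      · linarith
    have he1 : 0 < 1 - e := by linarith
    have ha : (⌊x⌋ : ℝ) - x = -e := by rw [he]; ring
    have hb : ((⌊x⌋ + 1 : ℤ) : ℝ) - x = 1 - e := by rw [he]; push_cast; ring
    have h1 := sin_sq_le_norm_dirichlet hT (-e)
    have h2 := sin_sq_le_norm_dirichlet hT (1 - e)
    rw [mul_neg, Real.sin_neg, neg_sq, neg_sq] at h1
    rw [mul_neg] at h1
    rw [ha, hb, mul_neg]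
    have h3 := eight_le_sin_sq_mul he0 (by linarith)
    rw [div_le_iff₀ (by positivity)]
    refine h3.trans ?_
    rw [add_mul]
    refine add_le_add ?_ ?_
    · rw [div_le_iff₀ (by positivity)]; linarith
    · rw [div_le_iff₀ (by positivity)]; linarith
  · obtain rfl : T = 1 := by omega
    refine h8.trans ?_
    have := Finset.single_le_sum nn (Finset.mem_range.2 hθ₀)
    rw [if_pos hE₀] at this
    simpa [dirichlet] using this

/-- Parseval's identity for the outcomes of phase estimation. -/
theorem sum_norm_dirichlet {T : ℕ} (hT : 0 < T) (β : ℝ) :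
    ∑ θ ∈ Finset.range T, ‖dirichlet T (2 * Real.pi * θ / T + β)‖ ^ 2 = 1 := by
  have hT' : (T : ℂ) ≠ 0 := by exact_mod_cast hT.ne'
  set ζ := Complex.exp (2 * Real.pi * Complex.I / T) with hζ
  have hprim : IsPrimitiveRoot ζ T := Complex.isPrimitiveRoot_exp T hT.ne'
  set b := Complex.exp (Complex.I * β) with hb
  have hbn : ∀ m : ℕ, b ^ m * (starRingEnd ℂ) (b ^ m) = 1 := by
    intro m
    rw [Complex.mul_conj, Complex.normSq_eq_norm_sq, norm_pow, hb, mul_comm,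
      Complex.norm_exp_ofReal_mul_I]
    simp
  have hconj : (starRingEnd ℂ) ζ = ζ⁻¹ := by
    rw [hζ, ← Complex.exp_conj, ← Complex.exp_neg]
    congr 1
    simp only [map_div₀, map_mul, Complex.conj_ofReal, Complex.conj_I, Complex.conj_natCast,
      Complex.conj_ofNat]
    ring
  have hterm : ∀ θ : ℕ, dirichlet T (2 * Real.pi * θ / T + β) =
      (T : ℂ)⁻¹ * ∑ m ∈ Finset.range T, b ^ m * (ζ ^ m) ^ θ := by
    intro θ
    unfold dirichlet
    congr 1
    refine Finset.sum_congr rfl fun m _ => ?_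
    rw [hb, hζ, ← Complex.exp_nat_mul, ← Complex.exp_nat_mul, ← Complex.exp_nat_mul,
      ← Complex.exp_nat_mul, ← Complex.exp_add]
    congr 1; push_cast; ring
  have horth : ∀ m ∈ Finset.range T, ∀ l ∈ Finset.range T,
      ∑ θ ∈ Finset.range T, (ζ ^ m) ^ θ * ((ζ⁻¹) ^ l) ^ θ = if l = m then (T : ℂ) else 0 := by
    intro m hm l hl
    rw [Finset.mem_range] at hm hl
    have hζ0 : ζ ≠ 0 := Complex.exp_ne_zero _
    split_ifs with h
    · subst h
      simp_rw [← mul_pow]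
      simp [hζ0]
    · simp_rw [← mul_pow]
      have hne : ζ ^ m * ζ⁻¹ ^ l ≠ 1 := by
        intro h1
        rw [inv_pow, mul_inv_eq_one₀ (pow_ne_zero _ hζ0)] at h1
        exact h (hprim.pow_inj hm hl h1).symm
      have := geom_sum_mul (ζ ^ m * ζ⁻¹ ^ l) T
      have h1 : (ζ ^ m * ζ⁻¹ ^ l) ^ T = 1 := by
        rw [mul_pow, ← pow_mul, ← pow_mul, mul_comm m, mul_comm l, pow_mul, pow_mul, inv_pow,
          hprim.pow_eq_one]; simp
      rw [h1, sub_self] at this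
      exact (mul_eq_zero.1 this).resolve_right (sub_ne_zero.2 hne)
  have : ((∑ θ ∈ Finset.range T, ‖dirichlet T (2 * Real.pi * θ / T + β)‖ ^ 2 : ℝ) : ℂ) = 1 := by
    push_cast
    have h1 : ∀ θ : ℕ, ((‖dirichlet T (2 * Real.pi * θ / T + β)‖ : ℝ) : ℂ) ^ 2 =
        ∑ m ∈ Finset.range T, ∑ l ∈ Finset.range T, (T : ℂ)⁻¹ ^ 2 *
          (b ^ m * (starRingEnd ℂ) (b ^ l)) * ((ζ ^ m) ^ θ * ((ζ⁻¹) ^ l) ^ θ) := by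
      intro θ
      rw [← Complex.mul_conj', hterm, map_mul, map_sum, mul_mul_mul_comm, Finset.sum_mul_sum,
        Finset.mul_sum]
      refine Finset.sum_congr rfl fun m _ => ?_
      rw [Finset.mul_sum]
      refine Finset.sum_congr rfl fun l _ => ?_
      simp only [map_mul, map_pow, map_inv₀, Complex.conj_natCast, hconj]
      ring
    simp_rw [h1]
    rw [Finset.sum_comm]
    have h2 : ∀ m ∈ Finset.range T, ∑ θ ∈ Finset.range T, ∑ l ∈ Finset.range T, (T : ℂ)⁻¹ ^ 2 *
          (b ^ m * (starRingEnd ℂ) (b ^ l)) * ((ζ ^ m) ^ θ * ((ζ⁻¹) ^ l) ^ θ) = (T : ℂ)⁻¹ := by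
      intro m hm
      rw [Finset.sum_comm]
      have h3 : ∀ l ∈ Finset.range T, ∑ θ ∈ Finset.range T, (T : ℂ)⁻¹ ^ 2 *
          (b ^ m * (starRingEnd ℂ) (b ^ l)) * ((ζ ^ m) ^ θ * ((ζ⁻¹) ^ l) ^ θ) =
          if l = m then (T : ℂ)⁻¹ else 0 := by
        intro l hl
        rw [← Finset.mul_sum, horth m hm l hl]
        split_ifs with h
        · subst h
          rw [hbn]; field_simp
        · simp
      rw [Finset.sum_congr rfl h3, Finset.sum_ite_eq' , if_pos hm]
    rw [Finset.sum_congr rfl h2]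
    simp [hT']
  exact_mod_cast this

/-! ### From the phase error to the error of the estimate -/

/-- The error of the estimate `cos² (π θ / T)` of `sin² ψ`. -/
theorem abs_cos_sq_sub_sin_sq_le {a ψ η : ℝ} {j : ℤ}
    (h : |2 * a + (Real.pi + 2 * ψ) - 2 * Real.pi * j| ≤ 2 * η) :
    |Real.cos a ^ 2 - Real.sin ψ ^ 2| ≤ 2 * |Real.sin ψ| * η + η ^ 2 := by
  -- This is half the phase error. Up to sign `cos a = sin(e - ψ)`, and `sin² A - sin² B = sin(A+B)
  -- sin(A-B)` isolates a factor `sin e`.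
  set e : ℝ := a + Real.pi / 2 + ψ - Real.pi * j with he
  have hη : |e| ≤ η := by
    have h1 : 2 * a + (Real.pi + 2 * ψ) - 2 * Real.pi * j = 2 * e := by rw [he]; ring
    rw [h1, abs_mul, abs_two] at h
    linarith
  have hcos : Real.cos a ^ 2 = Real.sin (e - ψ) ^ 2 := by
    have h1 : a = (e - ψ) - Real.pi / 2 + j * Real.pi := by rw [he]; ring
    rw [h1, Real.cos_add_int_mul_pi, Real.cos_sub_pi_div_two, mul_pow, ← zpow_natCast, ← zpow_mul,
      mul_comm j, zpow_mul]
    simp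
  have hid : Real.sin (e - ψ) ^ 2 - Real.sin ψ ^ 2 = Real.sin e * Real.sin (e - 2 * ψ) := by
    have h1 : ∀ A, Real.sin A ^ 2 - Real.sin ψ ^ 2 = Real.sin (A + ψ) * Real.sin (A - ψ) := by
      intro A
      rw [Real.sin_add, Real.sin_sub]
      linear_combination Real.sin ψ ^ 2 * Real.sin_sq_add_cos_sq A -
        Real.sin A ^ 2 * Real.sin_sq_add_cos_sq ψ
    rw [h1]; congr 2 <;> ring
  have h0 : 0 ≤ η := (abs_nonneg e).trans hη
  have hs1 : |Real.sin e| ≤ η := Real.abs_sin_le_abs.trans hη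
  have hs2 : |Real.sin (e - 2 * ψ)| ≤ η + 2 * |Real.sin ψ| := by
    rw [Real.sin_sub, Real.sin_two_mul]
    refine (abs_sub _ _).trans (add_le_add ?_ ?_)
    · rw [abs_mul]
      exact (mul_le_of_le_one_right (abs_nonneg _) (Real.abs_cos_le_one _)).trans hs1
    · rw [abs_mul, abs_mul, abs_mul, abs_two]
      have h1 := mul_le_of_le_one_left (b := |Real.cos ψ|) (a := |Real.cos e|) (abs_nonneg _)
        (Real.abs_cos_le_one e)
      have h2 := h1.trans (Real.abs_cos_le_one ψ)
      nlinarith [abs_nonneg (Real.sin ψ)]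
  rw [hcos, hid, abs_mul]
  calc _ ≤ η * (η + 2 * |Real.sin ψ|) := mul_le_mul hs1 hs2 (abs_nonneg _) h0
    _ = _ := by ring

/-- The relative and absolute error bounds of the estimate, from the error `η` of the phase. -/
theorem error_bounds {s smin η v : ℝ} (hs : 0 ≤ s) (hsmin : 0 < smin) (hη0 : 0 ≤ η)
    (hη : η < Real.pi / 100 * √smin) (hv : |v - s| ≤ 2 * √s * η + η ^ 2) :
    (smin ≤ s →
        |v / s - 1| < 2 * Real.pi / 100 * √(smin / s) + Real.pi ^ 2 / 10 ^ 4 * (smin / s) ∧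
        2 * Real.pi / 100 * √(smin / s) + Real.pi ^ 2 / 10 ^ 4 * (smin / s) < 0.07) ∧
      (s < smin →
        |v - s| / smin < 2 * Real.pi / 100 * √(s / smin) + Real.pi ^ 2 / 10 ^ 4 ∧
        2 * Real.pi / 100 * √(s / smin) + Real.pi ^ 2 / 10 ^ 4 < 0.07) := by
  have hpi := Real.pi_gt_d2
  have hpi' := Real.pi_lt_d2
  have hp2 : Real.pi ^ 2 < 10 := by nlinarith
  -- One absolute bound serves both regimes: divide by `s` or by `smin`. The quotient under the root
  -- is then at most 1, and `0.063 + 0.001 < 0.07`.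
  have h1 : |v - s| < 2 * Real.pi / 100 * (√s * √smin) + Real.pi ^ 2 / 10 ^ 4 * smin := by
    have h2 : η ^ 2 < (Real.pi / 100 * √smin) ^ 2 := pow_lt_pow_left₀ hη hη0 two_ne_zero
    rw [mul_pow, Real.sq_sqrt hsmin.le] at h2
    have h3 := mul_le_mul_of_nonneg_left hη.le (Real.sqrt_nonneg s)
    nlinarith
  constructor
  · intro h
    have hs' : 0 < s := hsmin.trans_le h
    have hq : √s * √s = s := Real.mul_self_sqrt hs
    have hx : smin / s ≤ 1 := (div_le_one hs').2 h
    have hx1 : √(smin / s) ≤ 1 := Real.sqrt_le_one.2 hx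
    have hx0 : 0 ≤ smin / s := by positivity
    refine ⟨?_, by nlinarith [Real.sqrt_nonneg (smin / s)]⟩
    have : v / s - 1 = (v - s) / s := by field_simp
    rw [this, abs_div, abs_of_pos hs', div_lt_iff₀ hs', Real.sqrt_div hsmin.le]
    refine h1.trans_eq ?_
    have : √smin / √s * s = √s * √smin := by
      rw [div_mul_eq_mul_div, div_eq_iff (Real.sqrt_pos.2 hs').ne']
      linear_combination -√smin * hq
    rw [add_mul, mul_assoc _ (√smin / √s), this, mul_assoc _ (smin / s), div_mul_cancel₀ _ hs'.ne']
  · intro h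
    have hq : √smin * √smin = smin := Real.mul_self_sqrt hsmin.le
    have hx : s / smin ≤ 1 := (div_le_one hsmin).2 h.le
    have hx1 : √(s / smin) ≤ 1 := Real.sqrt_le_one.2 hx
    have hx0 : 0 ≤ s / smin := by positivity
    refine ⟨?_, by nlinarith [Real.sqrt_nonneg (s / smin)]⟩
    rw [div_lt_iff₀ hsmin, Real.sqrt_div hs]
    refine h1.trans_eq ?_
    have : √s / √smin * smin = √s * √smin := by
      rw [div_mul_eq_mul_div, div_eq_iff (Real.sqrt_pos.2 hsmin).ne']
      linear_combination -√s * hq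
    rw [add_mul, mul_assoc _ (√s / √smin), this]

open Matrix

/-! ### Permutation gates -/

section permGate

variable {ι κ : Type} [DecidableEq ι] [DecidableEq κ]

/-- In general the action is precomposition with `σ⁻¹`; for an involution this is `σ` itself. -/
theorem permGate_mulVec [Fintype ι] {σ : ι → ι} (hσ : Function.Involutive σ) (v : ι → ℂ) (i : ι) :
    (permGate σ *ᵥ v) i = v (σ i) := by
  have h : ∀ j, (i = σ j) ↔ (σ i = j) := fun j => ⟨fun h => by rw [h, hσ], fun h => by rw [← h, hσ]⟩
  simp [permGate, mulVec, dotProduct, h]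

theorem permGate_mul [Fintype ι] (σ τ : ι → ι) :
    permGate σ * permGate τ = permGate (σ ∘ τ) := by
  ext i j
  simp [permGate, mul_apply]

theorem permGate_id : permGate (fun i : ι => i) = 1 := by
  ext i j; simp [permGate, one_apply]

theorem permGate_conjTranspose {σ : ι → ι} (hσ : Function.Involutive σ) :
    (permGate σ)ᴴ = permGate σ := by
  ext i j
  have h : (j = σ i) ↔ (i = σ j) := ⟨fun h => by rw [h, hσ], fun h => by rw [h, hσ]⟩
  simp only [permGate, conjTranspose_apply, of_apply, h]
  split_ifs <;> simp

theorem permGate_mul_self [Fintype ι] {σ : ι → ι} (hσ : Function.Involutive σ) :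
    permGate σ * permGate σ = 1 := by
  rw [permGate_mul, hσ.comp_self]; exact permGate_id

theorem diagonal_mul_permGate [Fintype ι] (σ : ι → ι) (d : ι → ℂ) :
    diagonal d * permGate σ = permGate σ * diagonal (d ∘ σ) := by
  ext i j
  simp only [permGate, diagonal_mul, mul_diagonal, of_apply, Function.comp]
  split_ifs with h <;> simp [h]

theorem permGate_kronecker_one (σ : ι → ι) :
    permGate σ ⊗ₖ (1 : Matrix κ κ ℂ) = permGate fun s : ι × κ => (σ s.1, s.2) := by
  ext ⟨i, k⟩ ⟨j, l⟩
  simp only [kroneckerMap_apply, permGate, of_apply, one_apply, Prod.mk.injEq]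
  by_cases h1 : i = σ j <;> by_cases h2 : k = l <;> simp [h1, h2]

theorem diagonal_kronecker_one' (d : ι → ℂ) :
    diagonal d ⊗ₖ (1 : Matrix κ κ ℂ) = diagonal fun s : ι × κ => d s.1 := by
  ext ⟨i, k⟩ ⟨j, l⟩
  simp only [kroneckerMap_apply, diagonal_apply, one_apply, Prod.mk.injEq]
  by_cases h1 : i = j <;> by_cases h2 : k = l <;> simp [h1, h2]

end permGate

theorem zmod_two_cases (a : ZMod 2) : a = 0 ∨ a = 1 := by
  revert a; decide

theorem zmod_two_add_self_left {ι : Type} (a b : ι → ZMod 2) : a + b + b = a := by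
  ext i; simp only [Pi.add_apply]; generalize a i = x; generalize b i = y; revert x y; decide

theorem sum_zmod_two {M : Type*} [AddCommMonoid M] (g : ZMod 2 → M) : ∑ b, g b = g 0 + g 1 :=
  Fin.sum_univ_two g

/-! ### The tests -/

/-- `SWAP(0,m) Z(x) X_0^b V(μ,ν)`, the part of `U_t` after the Hadamard gates. -/
def testPrep {n k : ℕ} [NeZero n] (d : TestData n k) : Matrix (AD n k) (AD n k) ℂ :=
  let swapGate : Matrix (AD n k) (AD n k) ℂ := permGate fun s => (s.1 ∘ Equiv.swap 0 d.2.1, s.2)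
  let zGate : Matrix (AD n k) (AD n k) ℂ :=
    diagonal fun s => ∏ j, (-1) ^ ((d.2.2.1 j).val * (s.1 j).val)
  let xGate : Matrix (AD n k) (AD n k) ℂ := permGate fun s => (s.1 + Pi.single 0 d.2.2.2, s.2)
  let V : Matrix (AD n k) (AD n k) ℂ :=
    permGate fun s => (s.1, s.2 + if s.1 0 = 0 then d.1.1.1 else d.1.1.2)
  swapGate * zGate * xGate * V

theorem Ut_eq {n k : ℕ} [NeZero n] (d : TestData n k) :
    Ut d = testPrep d * (hadamard n ⊗ₖ (1 : Matrix (Bits k) (Bits k) ℂ)) := rfl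

section invol
variable {n k : ℕ}

theorem involutive_swap (i j : Fin n) :
    Function.Involutive fun s : AD n k => ((s.1 ∘ Equiv.swap i j, s.2) : AD n k) := by
  intro s; ext <;> simp

theorem involutive_shift (y : Bits n) :
    Function.Involutive fun s : AD n k => ((s.1 + y, s.2) : AD n k) := by
  intro s; simp only [zmod_two_add_self_left]

theorem involutive_data (g : Bits n → Bits k) :
    Function.Involutive fun s : AD n k => ((s.1, s.2 + g s.1) : AD n k) := by
  intro s; simp only [zmod_two_add_self_left]

theorem involutive_anc {ι : Type} (g : ι → ZMod 2) :
    Function.Involutive fun s : ι × ZMod 2 => ((s.1, s.2 + g s.1) : ι × ZMod 2) := by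
  intro s
  refine Prod.ext rfl ?_
  change s.2 + g s.1 + g s.1 = s.2
  generalize s.2 = x; generalize g s.1 = y; revert x y; decide

end invol

theorem neg_one_pow_sq (m : ℕ) : ((-1 : ℂ) ^ m) * (-1) ^ m = 1 := by
  rw [← mul_pow]; simp

theorem testPrep_unitary {n k : ℕ} [NeZero n] (d : TestData n k) :
    (testPrep d)ᴴ * testPrep d = 1 := by
  have hz : (diagonal fun s : AD n k =>
      ∏ j, (-1 : ℂ) ^ ((d.2.2.1 j).val * (s.1 j).val))ᴴ *
      (diagonal fun s : AD n k => ∏ j, (-1) ^ ((d.2.2.1 j).val * (s.1 j).val)) = 1 := by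
    rw [diagonal_conjTranspose, diagonal_mul_diagonal, ← diagonal_one]
    congr 1; ext s
    simp only [Pi.star_apply, star_prod, star_pow, star_neg, star_one, ← Finset.prod_mul_distrib,
      neg_one_pow_sq, Finset.prod_const_one]
  have hp : ∀ σ : AD n k → AD n k, Function.Involutive σ →
      (permGate σ)ᴴ * permGate σ = (1 : Matrix (AD n k) (AD n k) ℂ) := fun σ hσ => by
    rw [permGate_conjTranspose hσ, permGate_mul_self hσ]
  have hm : ∀ A B : Matrix (AD n k) (AD n k) ℂ, Aᴴ * A = 1 → Bᴴ * B = 1 →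
      (A * B)ᴴ * (A * B) = 1 := fun A B hA hB => by
    rw [conjTranspose_mul, Matrix.mul_assoc, ← Matrix.mul_assoc Aᴴ, hA, Matrix.one_mul, hB]
  exact hm _ _ (hm _ _ (hm _ _ (hp _ (involutive_swap _ _)) hz) (hp _ (involutive_shift _)))
    (hp _ (involutive_data fun a => if a 0 = 0 then d.1.1.1 else d.1.1.2))

/-- The data string put into superposition by a test, as a function of the first address qubit. -/
def testString {n k : ℕ} (d : TestData n k) (b : ZMod 2) : Bits k :=
  if b = 0 then d.1.1.1 else d.1.1.2

/-- Bob's phase depends on the data register alone, so it passes unchanged through the swap, `Z` and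
`X` gates. Only `V` moves the data, by the string that the first address qubit selects. -/
theorem Uf_mul_testPrep {n k : ℕ} [NeZero n] (d : TestData n k) (g : Bits k → ZMod 2) :
    Uf n g * testPrep d =
      testPrep d * diagonal fun s => (-1) ^ (g (s.2 + testString d (s.1 0))).val := by
  have hc : ∀ d d' : AD n k → ℂ, diagonal d * diagonal d' = diagonal d' * diagonal d := fun d d' => by
    rw [diagonal_mul_diagonal, diagonal_mul_diagonal]; congr 1; ext; apply mul_comm
  unfold testPrep Uf
  simp only [Matrix.mul_assoc]
  rw [← Matrix.mul_assoc, diagonal_mul_permGate, Matrix.mul_assoc, ← Matrix.mul_assoc (diagonal _),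
    hc, Matrix.mul_assoc, ← Matrix.mul_assoc (diagonal (_ ∘ _)), diagonal_mul_permGate,
    Matrix.mul_assoc, diagonal_mul_permGate]
  rfl

section ancGate

variable {ι : Type} [DecidableEq ι] [Fintype ι]

/-- The gate `|i⟩|b⟩ ↦ |i⟩|b ⊕ g(i)⟩`. -/
def ancGate (g : ι → ZMod 2) : Matrix (ι × ZMod 2) (ι × ZMod 2) ℂ :=
  permGate fun s => (s.1, s.2 + g s.1)

theorem ancGate_mul_permGate (g : ι → ZMod 2) (σ : ι → ι) :
    ancGate g * (permGate σ ⊗ₖ (1 : Matrix (ZMod 2) (ZMod 2) ℂ)) =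
      (permGate σ ⊗ₖ (1 : Matrix (ZMod 2) (ZMod 2) ℂ)) * ancGate (g ∘ σ) := by
  rw [permGate_kronecker_one, ancGate, ancGate, permGate_mul, permGate_mul]
  rfl

theorem ancGate_mul_diagonal (g : ι → ZMod 2) (d : ι → ℂ) :
    ancGate g * (diagonal d ⊗ₖ (1 : Matrix (ZMod 2) (ZMod 2) ℂ)) =
      (diagonal d ⊗ₖ (1 : Matrix (ZMod 2) (ZMod 2) ℂ)) * ancGate g := by
  rw [diagonal_kronecker_one', ancGate, diagonal_mul_permGate]
  rfl

end ancGate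

theorem mul_kronecker_one {ι κ : Type} [Fintype ι] [DecidableEq κ] [Fintype κ] (A B : Matrix ι ι ℂ) :
    (A * B) ⊗ₖ (1 : Matrix κ κ ℂ) = (A ⊗ₖ 1) * (B ⊗ₖ 1) := by
  rw [← mul_kronecker_mul, Matrix.one_mul]

theorem anc_mul_testPrep {n k : ℕ} [NeZero n] (d : TestData n k) (f : Bits k → ZMod 2) :
    ancGate (fun s : AD n k => f s.2) * (testPrep d ⊗ₖ (1 : Matrix (ZMod 2) (ZMod 2) ℂ)) =
      (testPrep d ⊗ₖ (1 : Matrix (ZMod 2) (ZMod 2) ℂ)) *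
        ancGate fun s : AD n k => f (s.2 + testString d (s.1 0)) := by
  unfold testPrep
  simp only [mul_kronecker_one, Matrix.mul_assoc]
  rw [← Matrix.mul_assoc, ancGate_mul_permGate, Matrix.mul_assoc, ← Matrix.mul_assoc (ancGate _),
    ancGate_mul_diagonal, Matrix.mul_assoc, ← Matrix.mul_assoc (ancGate _), ancGate_mul_permGate,
    Matrix.mul_assoc, ancGate_mul_permGate]
  rfl

/-- The Hadamard gates, applied to a function of the first address qubit. -/
theorem hadamard_conj_apply {n : ℕ} [NeZero n] (P : ZMod 2 → ℂ) (v : Bits n) :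
    ∑ a : Bits n, star (hadamard n a v) * (P (a 0) * hadamard n a 0) =
      if ∀ j, j ≠ 0 → v j = 0 then (P 0 + P 1 * (-1) ^ (v 0).val) / 2 else 0 := by
  have h2 : ((√2 : ℝ) : ℂ)⁻¹ * ((√2 : ℝ) : ℂ)⁻¹ = 1 / 2 := by
    rw [← mul_inv, ← Complex.ofReal_mul, Real.mul_self_sqrt (by norm_num)]; norm_num
  -- The summand is a product over the address qubits, so the sum factors. A qubit `j ≠ 0`
  -- contributes `(1 + (-1)^{v_j})/2`, which vanishes unless `v_j = 0`.
  have hterm : ∀ a : Bits n, star (hadamard n a v) * (P (a 0) * hadamard n a 0) =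
      ∏ j, (if j = 0 then P (a j) else 1) * (1 / 2 * (-1) ^ ((a j).val * (v j).val)) := by
    intro a
    rw [Finset.prod_mul_distrib, Finset.prod_ite_eq' Finset.univ (0 : Fin n) fun j => P (a j),
      if_pos (Finset.mem_univ _)]
    simp only [hadamard, of_apply, hGate, star_prod, Pi.zero_apply, ZMod.val_zero, mul_zero,
      pow_zero, mul_one]
    rw [mul_left_comm, ← Finset.prod_mul_distrib]
    congr 1
    refine Finset.prod_congr rfl fun j _ => ?_
    rw [← h2]
    simp only [star_mul', star_pow, star_neg, star_one, star_inv₀, Complex.star_def,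
      Complex.conj_ofReal]
    ring
  simp_rw [hterm]
  rw [← Fintype.prod_sum fun (j : Fin n) (b : ZMod 2) =>
    (if j = 0 then P b else 1) * (1 / 2 * (-1 : ℂ) ^ (b.val * (v j).val))]
  simp only [sum_zmod_two, ZMod.val_zero, zero_mul, pow_zero, ZMod.val_one, one_mul, mul_one]
  rw [← Finset.mul_prod_erase Finset.univ _ (Finset.mem_univ (0 : Fin n))]
  simp only [if_true]
  split_ifs with h
  · rw [Finset.prod_eq_one]
    · ring
    · intro j hj
      have hj' := Finset.ne_of_mem_erase hj
      simp only [hj', if_false, h j hj', ZMod.val_zero, pow_zero]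
      norm_num
  · push Not at h
    obtain ⟨j, hj, hv⟩ := h
    rw [Finset.prod_eq_zero (Finset.mem_erase.2 ⟨hj, Finset.mem_univ _⟩), mul_zero]
    have hv1 : v j = 1 := (zmod_two_cases (v j)).resolve_left hv
    simp only [hj, if_false, hv1, ZMod.val_one, pow_one]
    norm_num

theorem sum_mul_ket {ι : Type} [Fintype ι] [DecidableEq ι] (g : ι → ℂ) (i : ι) :
    ∑ j, g j * ket i j = g i := by
  simp [ket, Pi.single_apply]

/-- After the unitary preparation cancels, what remains is a phase on the first address qubit
between two layers of Hadamard gates, with the data still at 0. -/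
theorem test_state {n k : ℕ} [NeZero n] (d : TestData n k) (g : Bits k → ZMod 2)
    (v : Bits n) (τ : Bits k) :
    (((Ut d)ᴴ * Uf n g * Ut d) *ᵥ ket (0, 0)) (v, τ) =
      if τ = 0 ∧ ∀ j, j ≠ 0 → v j = 0 then
        ((-1) ^ (g (testString d 0)).val + (-1) ^ (g (testString d 1)).val * (-1) ^ (v 0).val) / 2
      else 0 := by
  have h1 : (Ut d)ᴴ * Uf n g * Ut d = (hadamard n ⊗ₖ (1 : Matrix (Bits k) (Bits k) ℂ))ᴴ *
      ((diagonal fun s => (-1) ^ (g (s.2 + testString d (s.1 0))).val) *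
        (hadamard n ⊗ₖ (1 : Matrix (Bits k) (Bits k) ℂ))) := by
    rw [Ut_eq, conjTranspose_mul, Matrix.mul_assoc, ← Matrix.mul_assoc (Uf n g), Uf_mul_testPrep]
    simp only [Matrix.mul_assoc]
    rw [← Matrix.mul_assoc (testPrep d)ᴴ, testPrep_unitary, Matrix.one_mul]
  rw [h1, mulVec, dotProduct, sum_mul_ket, mul_apply, Fintype.sum_prod_type]
  simp only [diagonal_mul, conjTranspose_apply, kroneckerMap_apply, one_apply]
  by_cases hτ : τ = 0
  · subst hτ
    have h := hadamard_conj_apply (fun b => (-1 : ℂ) ^ (g (testString d b)).val) v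
    simp only [true_and]
    rw [← h]
    refine Finset.sum_congr rfl fun a _ => ?_
    rw [Finset.sum_eq_single 0]
    · simp
    · intro b _ hb; simp [hb]
    · simp
  · rw [if_neg (by simp [hτ])]
    refine Finset.sum_eq_zero fun a _ => Finset.sum_eq_zero fun b _ => ?_
    by_cases hb : b = τ
    · subst hb; simp [hτ]
    · simp [hb]

theorem test_state' {n k : ℕ} [NeZero n] (d : TestData n k) (f : Bits k → ZMod 2)
    (v : Bits n) (τ : Bits k) (b : ZMod 2) :
    (((Ut d ⊗ₖ (1 : Matrix (ZMod 2) (ZMod 2) ℂ))ᴴ *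
        ancGate (fun s : AD n k => f s.2) *
        (Ut d ⊗ₖ (1 : Matrix (ZMod 2) (ZMod 2) ℂ))) *ᵥ ket ((0, 0), 0)) ((v, τ), b) =
      if τ = 0 ∧ ∀ j, j ≠ 0 → v j = 0 then
        ((if b = f (testString d 0) then 1 else 0) +
          (if b = f (testString d 1) then 1 else 0) * (-1) ^ (v 0).val) / 2
      else 0 := by
  have hu : (testPrep d ⊗ₖ (1 : Matrix (ZMod 2) (ZMod 2) ℂ))ᴴ *
      (testPrep d ⊗ₖ (1 : Matrix (ZMod 2) (ZMod 2) ℂ)) = 1 := by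
    rw [conjTranspose_kronecker, ← mul_kronecker_mul, testPrep_unitary]; simp
  set W : Matrix (AD n k × ZMod 2) (AD n k × ZMod 2) ℂ :=
    (hadamard n ⊗ₖ (1 : Matrix (Bits k) (Bits k) ℂ)) ⊗ₖ (1 : Matrix (ZMod 2) (ZMod 2) ℂ) with hW
  have h1 : (Ut d ⊗ₖ (1 : Matrix (ZMod 2) (ZMod 2) ℂ))ᴴ *
        ancGate (fun s : AD n k => f s.2) *
        (Ut d ⊗ₖ (1 : Matrix (ZMod 2) (ZMod 2) ℂ)) = Wᴴ *
      (ancGate (fun s : AD n k => f (s.2 + testString d (s.1 0))) *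
        W) := by
    rw [Ut_eq, mul_kronecker_one, conjTranspose_mul, Matrix.mul_assoc, ← Matrix.mul_assoc (ancGate _),
      anc_mul_testPrep]
    simp only [Matrix.mul_assoc]
    rw [← Matrix.mul_assoc (testPrep d ⊗ₖ _)ᴴ, hu, Matrix.one_mul]
  rw [h1, ← mulVec_mulVec, ← mulVec_mulVec]
  have h2 : W *ᵥ ket ((0, 0), 0) = fun s => W s ((0, 0), 0) := by
    ext s; rw [mulVec, dotProduct, sum_mul_ket]
  rw [h2, mulVec, dotProduct, Fintype.sum_prod_type, Fintype.sum_prod_type]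
  simp only [ancGate, permGate_mulVec (involutive_anc fun a : AD n k => f (a.2 + testString d (a.1 0)))]
  simp only [hW, conjTranspose_apply, kroneckerMap_apply, one_apply]
  by_cases hτ : τ = 0
  · subst hτ
    have h := hadamard_conj_apply (fun c => if b = f (testString d c) then (1 : ℂ) else 0) v
    simp only [true_and]
    rw [← h]
    refine Finset.sum_congr rfl fun a _ => ?_
    rw [Finset.sum_eq_single 0]
    · rw [Finset.sum_eq_single b]
      · have : (b + f (testString d (a 0)) = 0) ↔ b = f (testString d (a 0)) := by
          generalize f (testString d (a 0)) = z; clear h; revert b z; decide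
        simp [this]
      · intro c _ hc; simp [hc]
      · simp
    · intro c _ hc; simp [hc]
    · simp
  · rw [if_neg (by simp [hτ])]
    refine Finset.sum_eq_zero fun a _ => Finset.sum_eq_zero fun c _ =>
      Finset.sum_eq_zero fun e _ => ?_
    by_cases hb : c = τ
    · subst hb; simp [hτ]
    · simp [hb]

/-- The pass probabilities divide by the number of test data, so this must be positive. The pair
consists of the zero string and the string whose only nonzero bit is the leading one. -/
instance {n k : ℕ} [NeZero n] [NeZero k] : Nonempty (TestData n k) := by
  refine ⟨⟨⟨(0, Pi.single 0 1), ?_⟩, 0, 0, 0⟩⟩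
  simp only [binVal, Pi.zero_apply, ZMod.val_zero, zero_mul, Finset.sum_const_zero]
  refine Finset.sum_pos' (fun _ _ => Nat.zero_le _) ⟨0, Finset.mem_univ _, ?_⟩
  simp [ZMod.val_one]

/-- The state is, up to sign, a basis vector: the Hadamard gate converts the relative sign of the
two branches into the bit `g(μ) ⊕ g(ν)`. Both measurements are thus deterministic and agree. -/
theorem passTest1_eq_one (n : ℕ) {k : ℕ} [NeZero n] [NeZero k] (g : Bits k → ZMod 2) :
    passTest1 n g = 1 := by
  unfold passTest1
  rw [div_eq_one_iff_eq (by exact_mod_cast Fintype.card_ne_zero), ← Finset.card_univ,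
    ← nsmul_one, ← Finset.sum_const]
  refine Finset.sum_congr rfl fun d _ => ?_
  simp only []
  set Φ := ((Ut d)ᴴ * Uf n g * Ut d) *ᵥ ket (0, 0) with hΦ
  set z : ZMod 2 := g (testString d 0) + g (testString d 1) with hz
  have hval : ∀ v τ, ‖Φ (v, τ)‖ ^ 2 = if (v, τ) = ((Pi.single 0 z, 0) : AD n k) then 1 else 0 := by
    intro v τ
    rw [hΦ, test_state]
    by_cases hc : τ = 0 ∧ ∀ j, j ≠ 0 → v j = 0
    · rw [if_pos hc]
      have hiff : (v, τ) = ((Pi.single 0 z, 0) : AD n k) ↔ v 0 = z := by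
        rw [Prod.mk.injEq]
        refine ⟨fun h => by rw [h.1]; simp, fun h => ⟨?_, hc.1⟩⟩
        ext j
        by_cases hj : j = 0
        · subst hj; simp [h]
        · simp [hj, hc.2 j hj]
      rw [if_congr hiff rfl rfl, hz]
      generalize v 0 = x; generalize g (testString d 0) = a; generalize g (testString d 1) = b
      rcases zmod_two_cases x with rfl | rfl <;> rcases zmod_two_cases a with rfl | rfl <;>
        rcases zmod_two_cases b with rfl | rfl <;> simp [ZMod.val_one, CharTwo.add_self_eq_zero]
    · rw [if_neg hc, if_neg]
      · simp
      · rintro h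
        rw [Prod.mk.injEq] at h
        refine hc ⟨h.2, fun j hj => ?_⟩
        rw [h.1]; simp [hj]
  rw [Finset.sum_eq_single (Pi.single 0 z, 0), Finset.sum_eq_single (Pi.single 0 z, 0)]
  · rw [if_pos, hval, if_pos rfl, mul_one]
    refine ⟨rfl, fun j hj => ?_, rfl, rfl⟩
    simp [hj]
  · rintro ⟨w, σ⟩ _ hw
    rw [hval w σ, if_neg hw]; simp
  · simp
  · rintro ⟨v, τ⟩ _ hv
    refine Finset.sum_eq_zero fun w _ => ?_
    rw [hval v τ, if_neg hv]; simp
  · simp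

-- Two identical copies form a swap-symmetric state, so the swap test returns 0 with certainty and
-- leaves `Φ ⊗ Φ`. The rest holds because `Φ` is normalized and supported where the measured qubits
-- vanish.
open Classical in
theorem passTest2_eq_one (n : ℕ) {k : ℕ} [NeZero n] [NeZero k] (f : Bits k → ZMod 2) :
    passTest2 n f = 1 := by
  unfold passTest2
  rw [div_eq_one_iff_eq (by exact_mod_cast Fintype.card_ne_zero), ← Finset.card_univ,
    ← nsmul_one, ← Finset.sum_const]
  refine Finset.sum_congr rfl fun d _ => ?_
  simp only []
  set Φ := ((Ut d ⊗ₖ (1 : Matrix (ZMod 2) (ZMod 2) ℂ))ᴴ *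
        ancGate (fun s : AD n k => f s.2) *
        (Ut d ⊗ₖ (1 : Matrix (ZMod 2) (ZMod 2) ℂ))) *ᵥ ket ((0, 0), 0) with hΦ
  have hzero : ∀ v : AD n k × ZMod 2, ¬(v.1.2 = 0 ∧ ∀ j, j ≠ 0 → v.1.1 j = 0) → Φ v = 0 := by
    rintro ⟨⟨v, τ⟩, b⟩ h
    rw [hΦ, test_state', if_neg h]
  have hnorm : ∑ v, ‖Φ v‖ ^ 2 = 1 := by
    rw [← Fintype.sum_of_injective
      (fun q : ZMod 2 × ZMod 2 => (((Pi.single 0 q.1, 0), q.2) : AD n k × ZMod 2))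
      (f := fun q => ‖((if q.2 = f (testString d 0) then 1 else 0) +
          (if q.2 = f (testString d 1) then 1 else 0) * (-1 : ℂ) ^ q.1.val) / 2‖ ^ 2)]
    · rw [Fintype.sum_prod_type, sum_zmod_two, sum_zmod_two, sum_zmod_two]
      generalize f (testString d 0) = a; generalize f (testString d 1) = b
      rcases zmod_two_cases a with rfl | rfl <;> rcases zmod_two_cases b with rfl | rfl <;>
        simp [ZMod.val_one] <;> norm_num
    · rintro ⟨a, b⟩ ⟨a', b'⟩ h
      simp only [Prod.mk.injEq, and_true] at h
      rw [Prod.mk.injEq]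
      refine ⟨?_, h.2⟩
      simpa using congrFun h.1 0
    · rintro ⟨⟨v, τ⟩, b⟩ h
      rw [hzero _ _]
      · simp
      · rintro ⟨h1, h2⟩
        refine h ⟨(v 0, b), ?_⟩
        simp only at h1 h2
        rw [h1]
        have h3 : (Pi.single 0 (v 0) : Bits n) = v := by
          ext j
          by_cases hj : j = 0
          · subst hj; simp
          · simp [hj, h2 j hj]
        simp only [h3]
    · rintro ⟨a, b⟩
      have h1 : (0 : Bits k) = 0 ∧ ∀ j : Fin n, j ≠ 0 → (Pi.single 0 a : Bits n) j = 0 :=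
        ⟨rfl, fun j hj => by simp [hj]⟩
      have h2 : Φ ((Pi.single 0 a, 0), b) = _ := (test_state' d f _ _ b).trans (if_pos h1)
      simp only [h2, Pi.single_eq_same]
  have hΨ : ∀ v w : AD n k × ZMod 2,
      ((hGate ⊗ₖ (1 : Matrix ((AD n k × ZMod 2) × AD n k × ZMod 2)
          ((AD n k × ZMod 2) × AD n k × ZMod 2) ℂ) *
        permGate fun s => if s.1 = 1 then (s.1, s.2.2, s.2.1) else s) *ᵥ
          fun s => ((√2 : ℝ) : ℂ)⁻¹ * Φ s.2.1 * Φ s.2.2) (0, v, w) = Φ v * Φ w := by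
    intro v w
    have hinv : Function.Involutive
        (fun s : ZMod 2 × (AD n k × ZMod 2) × AD n k × ZMod 2 =>
          if s.1 = 1 then (s.1, s.2.2, s.2.1) else s) := by
      rintro ⟨a, b, c⟩; by_cases hs : a = 1 <;> simp [hs]
    have h2 : ((√2 : ℝ) : ℂ)⁻¹ * ((√2 : ℝ) : ℂ)⁻¹ = 1 / 2 := by
      rw [← mul_inv, ← Complex.ofReal_mul, Real.mul_self_sqrt (by norm_num)]; norm_num
    rw [← mulVec_mulVec, mulVec, dotProduct, Fintype.sum_prod_type]
    simp only [permGate_mulVec hinv, kroneckerMap_apply, one_apply, sum_zmod_two]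
    rw [Finset.sum_eq_single (v, w), Finset.sum_eq_single (v, w)]
    · simp [hGate]
      linear_combination (2 * Φ v * Φ w) * h2
    · intro q _ hq; simp [hq.symm]
    · simp
    · intro q _ hq; simp [hq.symm]
    · simp
  have hsum : ∀ v w : AD n k × ZMod 2,
      (if (∀ j, j ≠ 0 → v.1.1 j = 0 ∧ w.1.1 j = 0) ∧ v.1.2 = 0 ∧ w.1.2 = 0
        then ‖Φ v * Φ w‖ ^ 2 else 0) = ‖Φ v‖ ^ 2 * ‖Φ w‖ ^ 2 := by
    intro v w
    split_ifs with h
    · rw [norm_mul, mul_pow]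
    · by_cases hv : v.1.2 = 0 ∧ ∀ j, j ≠ 0 → v.1.1 j = 0
      · rw [hzero w]
        · simp
        · rintro ⟨h1, h2⟩
          exact h ⟨fun j hj => ⟨hv.2 j hj, h2 j hj⟩, hv.1, h1⟩
      · rw [hzero v hv]; simp
  have hΦ' : ((Ut d ⊗ₖ (1 : Matrix (ZMod 2) (ZMod 2) ℂ))ᴴ *
        (permGate fun s : AD n k × ZMod 2 => (s.1, s.2 + f s.1.2)) *
        (Ut d ⊗ₖ (1 : Matrix (ZMod 2) (ZMod 2) ℂ))) *ᵥ ket ((0, 0), 0) = Φ := rfl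
  simp only [hΦ', hΨ, hsum]
  rw [← Finset.sum_mul_sum, hnorm, mul_one]

theorem survive_one (p : ℝ) : survive p 1 = 1 := by
  simp [survive]

/-! ### Binary values -/

section binVal

variable {t : ℕ}

theorem binVal_insert {M : Finset (Fin t)} {a : Fin t} (h : ∀ x ∈ M, a < x) (c : Bits t) :
    binVal (insert a M) c = (c a).val * 2 ^ M.card + binVal M c := by
  have ha : a ∉ M := fun h' => (h a h').false
  unfold binVal
  rw [Finset.sum_insert ha]
  have hf : (insert a M).filter (fun v => a < v) = M := by
    ext x
    simp only [Finset.mem_filter, Finset.mem_insert]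
    refine ⟨?_, fun hx => ⟨Or.inr hx, h x hx⟩⟩
    rintro ⟨rfl | hx, hlt⟩
    · exact absurd hlt (lt_irrefl _)
    · exact hx
  rw [hf]
  congr 1
  refine Finset.sum_congr rfl fun w hw => ?_
  rw [Finset.filter_insert, if_neg (h w hw).not_gt]

/-- Bits outside `M` are pinned to `c'`, while those in `M` enumerate `0, …, 2^#M - 1` once each.
Adjoining a new least index adds a most significant bit, which splits the range into two halves; `g`
is generalized because the upper half is shifted. -/
theorem sum_agree_binVal {R : Type*} [AddCommMonoid R] (M : Finset (Fin t)) (g : ℕ → R) :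
    ∀ c' : Bits t, ∑ c : Bits t, (if ∀ w, w ∉ M → c' w = c w then g (binVal M c) else 0) =
      ∑ m ∈ Finset.range (2 ^ M.card), g m := by
  induction M using Finset.induction_on_min generalizing g with
  | empty =>
    intro c'
    rw [Finset.sum_eq_single c']
    · simp [binVal]
    · intro c _ hc
      rw [if_neg]
      intro h
      exact hc (funext fun w => (h w (Finset.notMem_empty w)).symm)
    · simp
  | insert a M h ih =>
    intro c'
    have ha : a ∉ M := fun h' => (h a h').false
    have hstep : ∀ c : Bits t,
        (if ∀ w, w ∉ insert a M → c' w = c w then g (binVal (insert a M) c) else 0) =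
        ∑ b : ZMod 2, if ∀ w, w ∉ M → Function.update c' a b w = c w then
          g (b.val * 2 ^ M.card + binVal M c) else 0 := by
      intro c
      rw [Finset.sum_eq_single (c a), binVal_insert h]
      · refine if_congr ⟨fun H w hw => ?_, fun H w hw => ?_⟩ rfl rfl
        · by_cases hwa : w = a
          · subst hwa; simp
          · rw [Function.update_of_ne hwa]
            exact H w (by simp [hwa, hw])
        · rw [Finset.mem_insert, not_or] at hw
          rw [← H w hw.2, Function.update_of_ne hw.1]
      · intro b _ hb
        rw [if_neg]
        intro H
        have := H a ha
        rw [Function.update_self] at this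
        exact hb this
      · simp
    simp_rw [hstep]
    rw [Finset.sum_comm]
    simp_rw [fun b : ZMod 2 => ih (fun m => g (b.val * 2 ^ M.card + m)) (Function.update c' a b)]
    rw [sum_zmod_two, Finset.card_insert_of_notMem ha, pow_succ, mul_two, Finset.sum_range_add]
    simp [ZMod.val_one]

theorem sum_binVal (M : Finset (Fin t)) (g : ℕ → ℝ) :
    ∑ c : Bits t, g (binVal M c) =
      2 ^ t / 2 ^ M.card * ∑ m ∈ Finset.range (2 ^ M.card), g m := by
  -- Double counting over pairs that agree off `M`: every `c'` sees each value once, and every `c`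
  -- has `2^#M` partners.
  have h1 : ∑ c' : Bits t, ∑ c : Bits t,
      (if ∀ w, w ∉ M → c' w = c w then g (binVal M c) else 0) =
      2 ^ t * ∑ m ∈ Finset.range (2 ^ M.card), g m := by
    simp_rw [sum_agree_binVal M g]
    simp [ZMod.card]
  have h2 : ∑ c' : Bits t, ∑ c : Bits t,
      (if ∀ w, w ∉ M → c' w = c w then g (binVal M c) else 0) =
      2 ^ M.card * ∑ c : Bits t, g (binVal M c) := by
    rw [Finset.sum_comm, Finset.mul_sum]
    refine Finset.sum_congr rfl fun c _ => ?_
    have h := sum_agree_binVal M (fun _ => (1 : ℝ)) c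
    rw [Finset.sum_const, Finset.card_range, nsmul_eq_mul, mul_one] at h
    push_cast at h
    rw [← h, Finset.sum_mul]
    refine Finset.sum_congr rfl fun c' _ => ?_
    simp only [eq_comm (a := c _), ite_mul, one_mul, zero_mul]
  rw [h2] at h1
  field_simp
  linarith

end binVal

/-! ### Grover iterations -/

section grover

variable {n k : ℕ} (D : Database n k) (y : Bits n)

theorem UD_eq : UD D y = permGate fun s => (s.1, s.2 + D (s.1 + y)) := by
  unfold UD shiftX oracle
  rw [permGate_mul, permGate_mul]
  congr 1
  ext s : 1
  simp only [Function.comp, zmod_two_add_self_left]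

theorem UD_mulVec (v : AD n k → ℂ) (s : AD n k) :
    (UD D y *ᵥ v) s = v (s.1, s.2 + D (s.1 + y)) := by
  rw [UD_eq, permGate_mulVec (involutive_data fun x => D (x + y))]

theorem UD_mul_self : UD D y * UD D y = 1 := by
  rw [UD_eq, permGate_mul_self (involutive_data fun x => D (x + y))]

theorem plusKet_mul_self (n : ℕ) (x x' : Bits n) : plusKet n x * plusKet n x' = (2 ^ n)⁻¹ := by
  unfold plusKet
  rw [← mul_inv, ← Complex.ofReal_mul, Real.mul_self_sqrt (by positivity)]
  push_cast; rfl

theorem Gbar_mulVec (v : AD n k → ℂ) (x : Bits n) (τ : Bits k) :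
    (Gbar n k *ᵥ v) (x, τ) = v (x, τ) - 2 * (2 ^ n)⁻¹ * ∑ x', v (x', τ) := by
  have hs : ∀ x', star (plusKet n x') = plusKet n x' := by
    intro x'; simp [plusKet]
  simp only [Gbar, mulVec, dotProduct, Fintype.sum_prod_type, kroneckerMap_apply, Matrix.sub_apply,
    Matrix.smul_apply, vecMulVec_apply, Pi.star_apply, hs, plusKet_mul_self, smul_eq_mul]
  have h1 : ∀ x' : Bits n, ∑ τ' : Bits k, ((1 : Matrix (Bits n) (Bits n) ℂ) x x' - 2 * (2 ^ n)⁻¹) *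
      (1 : Matrix (Bits k) (Bits k) ℂ) τ τ' * v (x', τ') =
      (1 : Matrix (Bits n) (Bits n) ℂ) x x' * v (x', τ) - 2 * (2 ^ n)⁻¹ * v (x', τ) := by
    intro x'
    rw [Finset.sum_eq_single τ]
    · simp; ring
    · intro b _ hb; simp [one_apply, hb.symm]
    · simp
  simp_rw [h1]
  rw [Finset.sum_sub_distrib, ← Finset.mul_sum]
  congr 1
  simp [one_apply]

theorem iter_mulVec (f : Bits k → ZMod 2) (v : AD n k → ℂ) (x : Bits n) (τ : Bits k) :
    (iter D y f *ᵥ v) (x, τ) = (-1) ^ (f (τ + D (x + y))).val * v (x, τ) -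
      2 * (2 ^ n)⁻¹ * ∑ x', (-1) ^ (f (τ + D (x' + y))).val * v (x', τ) := by
  have h : ∀ s : AD n k, (UD D y *ᵥ Uf n f *ᵥ UD D y *ᵥ v) s =
      (-1) ^ (f (s.2 + D (s.1 + y))).val * v s := by
    intro s
    rw [UD_mulVec, Uf, mulVec_diagonal, UD_mulVec]
    simp only [zmod_two_add_self_left]
  unfold iter
  rw [← mulVec_mulVec, ← mulVec_mulVec, ← mulVec_mulVec, Gbar_mulVec]
  simp only [h]

variable {D} {f : Bits k → ZMod 2}

/-- Translation by `y` permutes the addresses, so the proportion of marked ones does not depend on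
the mask. -/
theorem sum_ite_eq_frac (a b : ℝ) :
    ∑ x : Bits n, (if f (D (x + y)) = 1 then a else b) =
      2 ^ n * (frac D f * a + (1 - frac D f) * b) := by
  have h0 : ∑ x : Bits n, ((f (D (x + y))).val : ℝ) = 2 ^ n * frac D f := by
    rw [Fintype.sum_equiv (Equiv.addRight y) (fun x : Bits n => ((f (D (x + y))).val : ℝ))
      (fun x => ((f (D x)).val : ℝ)) fun x => rfl, frac]
    field_simp
  have h1 : ∀ x : Bits n, (if f (D (x + y)) = 1 then a else b) =
      ((f (D (x + y))).val : ℝ) * (a - b) + b := by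
    intro x
    rcases zmod_two_cases (f (D (x + y))) with h | h <;> simp [h, ZMod.val_one]
  simp_rw [h1]
  rw [Finset.sum_add_distrib, ← Finset.sum_mul, h0]
  simp [ZMod.card]
  ring

theorem frac_nonneg : 0 ≤ frac D f := by
  unfold frac; positivity

theorem frac_le_one : frac D f ≤ 1 := by
  have h := sum_ite_eq_frac (D := D) (f := f) 0 0 1
  have h2 : 0 ≤ ∑ x : Bits n, (if f (D (x + 0)) = 1 then (0 : ℝ) else 1) :=
    Finset.sum_nonneg fun x _ => by split_ifs <;> norm_num
  rw [h] at h2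
  have := nonneg_of_mul_nonneg_right h2 (by positivity)
  linarith

variable (D f) in
/-- The angle `φ` with `sin² φ = f(D)`. -/
def angle : ℝ := Real.arcsin (√(frac D f))

theorem sin_angle : Real.sin (angle D f) = √(frac D f) :=
  Real.sin_arcsin ((by norm_num : (-1 : ℝ) ≤ 0).trans (Real.sqrt_nonneg _))
    (Real.sqrt_le_one.2 frac_le_one)

theorem sin_sq_angle : Real.sin (angle D f) ^ 2 = frac D f := by
  rw [sin_angle, Real.sq_sqrt frac_nonneg]

theorem cos_sq_angle : Real.cos (angle D f) ^ 2 = 1 - frac D f := by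
  have := Real.sin_sq_add_cos_sq (angle D f)
  rw [sin_sq_angle] at this
  linarith

/-- A marked address forces `f(D) > 0`. Thus the division in the marked branch of `amp` is
legitimate wherever that branch is taken, even if `f(D)` is 0 or 1. -/
theorem sin_angle_ne_zero {x : Bits n} (h : f (D (x + y)) = 1) : Real.sin (angle D f) ≠ 0 := by
  intro h0
  have hs := sin_sq_angle (D := D) (f := f)
  have h1 := sum_ite_eq_frac (D := D) (f := f) y 1 0
  rw [h0] at hs
  have h2 := Finset.single_le_sum
    (f := fun x : Bits n => if f (D (x + y)) = 1 then (1 : ℝ) else 0)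
    (fun x _ => by split_ifs <;> norm_num) (Finset.mem_univ x)
  simp only [h, if_true] at h2
  rw [h1, ← hs] at h2
  norm_num at h2

theorem cos_angle_ne_zero {x : Bits n} (h : f (D (x + y)) ≠ 1) : Real.cos (angle D f) ≠ 0 := by
  intro h0
  have hs := cos_sq_angle (D := D) (f := f)
  have h1 := sum_ite_eq_frac (D := D) (f := f) y 0 1
  rw [h0] at hs
  have h2 := Finset.single_le_sum
    (f := fun x : Bits n => if f (D (x + y)) = 1 then (0 : ℝ) else 1)
    (fun x _ => by split_ifs <;> norm_num) (Finset.mem_univ x)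
  simp only [h, if_false] at h2
  rw [h1, ← hs] at h2
  norm_num at h2

variable (D f) in
/-- The relative amplitude of the address `x` after `m` Grover iterations. -/
def amp (m : ℕ) (x : Bits n) : ℝ :=
  (-1) ^ m * if f (D (x + y)) = 1 then Real.sin ((2 * m + 1) * angle D f) / Real.sin (angle D f)
    else Real.cos ((2 * m + 1) * angle D f) / Real.cos (angle D f)

theorem amp_zero (x : Bits n) : amp D y f 0 x = 1 := by
  unfold amp
  split_ifs with h
  · simp [sin_angle_ne_zero y h]
  · simp [cos_angle_ne_zero y h]

theorem sum_sign_amp (m : ℕ) :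
    ∑ x, (-1) ^ (f (D (x + y))).val * amp D y f m x =
      2 ^ n * ((-1) ^ m * Real.cos ((2 * m + 2) * angle D f)) := by
  have h1 : ∀ x, (-1) ^ (f (D (x + y))).val * amp D y f m x =
      if f (D (x + y)) = 1 then
        (-1) ^ m * -(Real.sin ((2 * m + 1) * angle D f) / Real.sin (angle D f))
      else (-1) ^ m * (Real.cos ((2 * m + 1) * angle D f) / Real.cos (angle D f)) := by
    intro x
    unfold amp
    rcases zmod_two_cases (f (D (x + y))) with h | h <;> simp [h, ZMod.val_one]
  simp_rw [h1]
  rw [sum_ite_eq_frac, ← cos_sq_angle, ← sin_sq_angle]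
  have h2 : (2 * (m : ℝ) + 2) * angle D f = (2 * m + 1) * angle D f + angle D f := by ring
  rw [h2, Real.cos_add]
  -- This holds at `a = 0` too, since division by zero gives 0; no case distinction on the angle is
  -- needed.
  have h3 : ∀ a b : ℝ, a ^ 2 * (b / a) = a * b := by
    intro a b
    rcases eq_or_ne a 0 with rfl | ha
    · simp
    · field_simp
  linear_combination 2 ^ n * (-1) ^ m *
    (h3 (Real.cos (angle D f)) (Real.cos ((2 * m + 1) * angle D f)) -
      h3 (Real.sin (angle D f)) (Real.sin ((2 * m + 1) * angle D f)))

/-- With `A = (2m+2)φ`, these are the identities for `sin(A+φ) - sin(A-φ)` and `cos(A+φ) +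
cos(A-φ)`. The alternating sign in `amp` arises because `G` is the negative of the usual diffusion
operator. -/
theorem amp_succ (m : ℕ) (x : Bits n) :
    amp D y f (m + 1) x = (-1) ^ (f (D (x + y))).val * amp D y f m x -
      2 * ((-1) ^ m * Real.cos ((2 * m + 2) * angle D f)) := by
  have ha : (2 * ((m + 1 : ℕ) : ℝ) + 1) * angle D f = (2 * m + 2) * angle D f + angle D f := by
    push_cast; ring
  have hb : (2 * (m : ℝ) + 1) * angle D f = (2 * m + 2) * angle D f - angle D f := by ring
  unfold amp
  rw [ha, hb]
  by_cases h : f (D (x + y)) = 1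
  · have h0 := sin_angle_ne_zero y h
    simp only [h, if_true, ZMod.val_one, pow_one]
    rw [Real.sin_add, Real.sin_sub]
    field_simp
    ring
  · have h0 := cos_angle_ne_zero y h
    have h' := (zmod_two_cases (f (D (x + y)))).resolve_right h
    rw [if_neg h, if_neg h]
    simp only [h', ZMod.val_zero, pow_zero]
    rw [Real.cos_add, Real.cos_sub]
    field_simp
    ring

/-- The initial state of the address and data registers. -/
def startAD (n k : ℕ) : AD n k → ℂ := fun s => plusKet n s.1 * ket (0 : Bits k) s.2

theorem iter_pow_mulVec (m : ℕ) :
    iter D y f ^ m *ᵥ startAD n k = fun s => startAD n k s * (amp D y f m s.1 : ℝ) := by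
  induction m with
  | zero => ext s; simp [amp_zero]
  | succ m ih =>
    rw [pow_succ', ← mulVec_mulVec, ih]
    ext ⟨x, τ⟩
    rw [iter_mulVec]
    simp only [startAD]
    by_cases hτ : τ = 0
    · subst hτ
      have h1 := sum_sign_amp (D := D) (f := f) y m
      have h2 := amp_succ (D := D) (f := f) y m x
      have h1' := congrArg (fun z : ℝ => (z : ℂ)) h1
      have h2' := congrArg (fun z : ℝ => (z : ℂ)) h2
      simp only [Complex.ofReal_sum, Complex.ofReal_mul, Complex.ofReal_sub, Complex.ofReal_pow,
        Complex.ofReal_neg, Complex.ofReal_one] at h1' h2'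
      have h3 : ∑ x' : Bits n, (-1 : ℂ) ^ (f (0 + D (x' + y))).val *
          (plusKet n x' * ket (0 : Bits k) 0 * ((amp D y f m x' : ℝ) : ℂ)) =
          plusKet n x * ∑ x', (-1 : ℂ) ^ (f (D (x' + y))).val * (amp D y f m x' : ℝ) := by
        rw [Finset.mul_sum]
        refine Finset.sum_congr rfl fun x' _ => ?_
        simp [ket, plusKet]; ring
      rw [h3, h1', h2']
      have h4 : ((2 : ℂ) ^ n)⁻¹ * 2 ^ n = 1 := inv_mul_cancel₀ (pow_ne_zero _ two_ne_zero)
      simp only [zero_add, ket, Pi.single_eq_same, Complex.ofReal_ofNat]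
      linear_combination (-2 * plusKet n x * ((-1) ^ m *
        ((Real.cos ((2 * m + 2) * angle D f) : ℝ) : ℂ))) * h4
    · simp [ket, hτ]

/-- The distribution of the outcome of phase estimation on the Grover iteration, before the
normalization of the control register. -/
theorem sum_norm_phase_sum {T : ℕ} (hT : 0 < T) (α : ℝ) :
    ∑ s : AD n k, ‖∑ m ∈ Finset.range T, Complex.exp (Complex.I * α) ^ m *
        (iter D y f ^ m *ᵥ startAD n k) s‖ ^ 2 =
      T ^ 2 * ((‖dirichlet T (α + (Real.pi + 2 * angle D f))‖ ^ 2 +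
        ‖dirichlet T (α + (Real.pi + 2 * -angle D f))‖ ^ 2) / 2) := by
  set φ := angle D f with hφ
  set z := Complex.exp (Complex.I * α) with hz
  set A : ℂ := ∑ m ∈ Finset.range T, z ^ m * (((-1) ^ m * Real.sin ((2 * m + 1) * φ) : ℝ) : ℂ)
    with hA
  set B : ℂ := ∑ m ∈ Finset.range T, z ^ m * (((-1) ^ m * Real.cos ((2 * m + 1) * φ) : ℝ) : ℂ)
    with hB
  have hT' : (T : ℂ) ≠ 0 := by exact_mod_cast hT.ne'
  -- The eigenvalue `-exp(2iψ)` accounts for the shift `π + 2ψ`; the odd multiples `2m + 1` leave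
  -- only a global phase `exp(iψ)`.
  have hdir : ∀ ψ : ℝ, T * dirichlet T (α + (Real.pi + 2 * ψ)) * Complex.exp (ψ * Complex.I) =
      ∑ m ∈ Finset.range T, z ^ m * ((-1) ^ m * Complex.exp ((2 * m + 1) * ψ * Complex.I)) := by
    intro ψ
    unfold dirichlet
    rw [mul_inv_cancel_left₀ hT', Finset.sum_mul]
    refine Finset.sum_congr rfl fun m _ => ?_
    rw [← Complex.exp_pi_mul_I, hz, ← Complex.exp_nat_mul, ← Complex.exp_nat_mul,
      ← Complex.exp_nat_mul, ← Complex.exp_add, ← Complex.exp_add, ← Complex.exp_add]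
    congr 1; push_cast; ring
  have hplus : ‖B + Complex.I * A‖ = T * ‖dirichlet T (α + (Real.pi + 2 * φ))‖ := by
    have : B + Complex.I * A = T * dirichlet T (α + (Real.pi + 2 * φ)) *
        Complex.exp (φ * Complex.I) := by
      rw [hdir, hA, hB, Finset.mul_sum, ← Finset.sum_add_distrib]
      refine Finset.sum_congr rfl fun m _ => ?_
      rw [Complex.exp_mul_I]; push_cast; ring
    rw [this, norm_mul, norm_mul, Complex.norm_exp_ofReal_mul_I, mul_one, Complex.norm_natCast]
  have hminus : ‖B - Complex.I * A‖ = T * ‖dirichlet T (α + (Real.pi + 2 * -φ))‖ := by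
    have : B - Complex.I * A = T * dirichlet T (α + (Real.pi + 2 * -φ)) *
        Complex.exp ((-φ : ℝ) * Complex.I) := by
      rw [hdir, hA, hB, Finset.mul_sum, ← Finset.sum_sub_distrib]
      refine Finset.sum_congr rfl fun m _ => ?_
      have : (2 * (m : ℂ) + 1) * ((-φ : ℝ) : ℂ) = -((2 * m + 1) * φ) := by push_cast; ring
      rw [this, Complex.exp_mul_I, Complex.cos_neg, Complex.sin_neg]; push_cast; ring
    rw [this, norm_mul, norm_mul, Complex.norm_exp_ofReal_mul_I, mul_one, Complex.norm_natCast]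
  -- The weight on marked and unmarked addresses totals `‖A‖² + ‖B‖²`; the parallelogram law
  -- rewrites it as the mean of the two eigenphase weights.
  have hpar := parallelogram_law_with_norm ℝ B (Complex.I * A)
  rw [hplus, hminus, norm_mul, Complex.norm_I, one_mul] at hpar
  have hsum : ∀ s : AD n k, ‖∑ m ∈ Finset.range T, z ^ m *
      (iter D y f ^ m *ᵥ startAD n k) s‖ ^ 2 = ‖startAD n k s‖ ^ 2 *
        if f (D (s.1 + y)) = 1 then ‖A‖ ^ 2 / Real.sin φ ^ 2 else ‖B‖ ^ 2 / Real.cos φ ^ 2 := by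
    intro s
    simp only [iter_pow_mulVec]
    have : ∑ m ∈ Finset.range T, z ^ m * (startAD n k s * ((amp D y f m s.1 : ℝ) : ℂ)) =
        startAD n k s * if f (D (s.1 + y)) = 1 then A / (Real.sin φ : ℝ)
          else B / (Real.cos φ : ℝ) := by
      split_ifs with h
      · rw [hA, Finset.sum_div, Finset.mul_sum]
        refine Finset.sum_congr rfl fun m _ => ?_
        rw [amp, if_pos h]; push_cast; ring
      · rw [hB, Finset.sum_div, Finset.mul_sum]
        refine Finset.sum_congr rfl fun m _ => ?_
        rw [amp, if_neg h]; push_cast; ring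
    rw [this, norm_mul, mul_pow]
    split_ifs
    · rw [norm_div, div_pow, Complex.norm_real, Real.norm_eq_abs, sq_abs]
    · rw [norm_div, div_pow, Complex.norm_real, Real.norm_eq_abs, sq_abs]
  simp_rw [hsum]
  rw [Fintype.sum_prod_type]
  have hstart : ∀ x : Bits n, ∑ τ : Bits k, ‖startAD n k (x, τ)‖ ^ 2 *
      (if f (D (x + y)) = 1 then ‖A‖ ^ 2 / Real.sin φ ^ 2 else ‖B‖ ^ 2 / Real.cos φ ^ 2) =
      (2 ^ n)⁻¹ *
      (if f (D (x + y)) = 1 then ‖A‖ ^ 2 / Real.sin φ ^ 2 else ‖B‖ ^ 2 / Real.cos φ ^ 2) := by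
    intro x
    rw [Finset.sum_eq_single 0]
    · congr 1
      simp only [startAD, ket, Pi.single_eq_same, mul_one, plusKet]
      rw [norm_inv, Complex.norm_real, Real.norm_eq_abs, inv_pow, sq_abs,
        Real.sq_sqrt (by positivity)]
    · intro τ _ hτ
      simp [startAD, ket, hτ]
    · simp
  simp_rw [hstart]
  rw [← Finset.mul_sum, sum_ite_eq_frac, ← cos_sq_angle, ← sin_sq_angle, ← hφ]
  -- If `sin φ = 0`, every odd multiple of `φ` also has zero sine, so `A = 0` and both sides vanish.
  -- The cosine case is analogous.
  have h3 : Real.sin φ ^ 2 * (‖A‖ ^ 2 / Real.sin φ ^ 2) = ‖A‖ ^ 2 := by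
    rcases eq_or_ne (Real.sin φ) 0 with h | h
    · have hA0 : A = 0 := by
        rw [hA]
        refine Finset.sum_eq_zero fun m _ => ?_
        obtain ⟨j, hj⟩ := Real.sin_eq_zero_iff.1 h
        have : Real.sin ((2 * m + 1) * φ) = 0 :=
          Real.sin_eq_zero_iff.2 ⟨(2 * m + 1) * j, by push_cast; rw [← hj]; ring⟩
        simp only [this]; simp
      simp [hA0]
    · field_simp
  have h4 : Real.cos φ ^ 2 * (‖B‖ ^ 2 / Real.cos φ ^ 2) = ‖B‖ ^ 2 := by
    rcases eq_or_ne (Real.cos φ) 0 with h | h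
    · have hB0 : B = 0 := by
        rw [hB]
        refine Finset.sum_eq_zero fun m _ => ?_
        obtain ⟨j, hj⟩ := Real.cos_eq_zero_iff.1 h
        have : Real.cos ((2 * m + 1) * φ) = 0 :=
          Real.cos_eq_zero_iff.2 ⟨(2 * m + 1) * j + m, by push_cast; rw [hj]; ring⟩
        simp only [this]; simp
      simp [hB0]
    · field_simp
  rw [h3, h4, inv_mul_cancel_left₀ (by positivity)]
  linarith

end grover

/-! ### The rounds of the protocol -/

section rounds

theorem kronecker_mulVec_mul {ι κ : Type} [Fintype ι] [Fintype κ] (A : Matrix ι ι ℂ)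
    (B : Matrix κ κ ℂ) (u : ι → ℂ) (v : κ → ℂ) :
    (A ⊗ₖ B) *ᵥ (fun s => u s.1 * v s.2) = fun s => (A *ᵥ u) s.1 * (B *ᵥ v) s.2 := by
  ext s
  simp only [mulVec, dotProduct, kroneckerMap_apply]
  rw [Fintype.sum_prod_type, Finset.sum_mul_sum]
  exact Finset.sum_congr rfl fun _ _ => Finset.sum_congr rfl fun _ _ => mul_mul_mul_comm _ _ _ _

theorem blockDiagonal_mulVec {ι κ : Type} [Fintype ι] [Fintype κ] [DecidableEq κ]
    (A : κ → Matrix ι ι ℂ) (v : ι × κ → ℂ) (i : ι) (j : κ) :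
    (blockDiagonal A *ᵥ v) (i, j) = (A j *ᵥ fun i' => v (i', j)) i := by
  simp only [mulVec, dotProduct, Fintype.sum_prod_type, blockDiagonal_apply, ite_mul, zero_mul]
  simp

variable {n k t : ℕ}

theorem onFst_mulVec (A : Matrix (Copy n k t) (Copy n k t) ℂ) (u v : Copy n k t → ℂ) :
    onFst A *ᵥ (fun s => u s.1 * v s.2) = fun s => (A *ᵥ u) s.1 * v s.2 := by
  rw [onFst, kronecker_mulVec_mul, one_mulVec]

theorem onSnd_mulVec (A : Matrix (Copy n k t) (Copy n k t) ℂ) (u v : Copy n k t → ℂ) :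
    onSnd A *ᵥ (fun s => u s.1 * v s.2) = fun s => u s.1 * (A *ᵥ v) s.2 := by
  rw [onSnd, kronecker_mulVec_mul, one_mulVec]

theorem onAD_mulVec (A : Matrix (AD n k) (AD n k) ℂ) (v : Copy n k t → ℂ) (a : AD n k)
    (c : Bits t) (b : ZMod 2) :
    (onAD t A *ᵥ v) ((a, c), b) = (A *ᵥ fun a' => v ((a', c), b)) a := by
  rw [onAD, blockDiagonal_mulVec, blockDiagonal_mulVec]

theorem controlled_mulVec (i : ℕ) (A : Matrix (AD n k) (AD n k) ℂ) (v : Copy n k t → ℂ)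
    (a : AD n k) (c : Bits t) (b : ZMod 2) :
    (controlled t i A *ᵥ v) ((a, c), b) =
      ((if ∃ w, InBlock w i ∧ c w = 1 then A else 1) *ᵥ fun a' => v ((a', c), b)) a := by
  rw [controlled, blockDiagonal_mulVec, blockDiagonal_mulVec]

variable (D : Database n k) (y : Bits n) (fs : ℕ → Bits k → ZMod 2)

/-- The operation on the address and data registers in the rounds `0, …, i-1`, if the control
register is in the state `|c⟩`. -/
def roundsEffect (c : Bits t) : ℕ → Matrix (AD n k) (AD n k) ℂ
  | 0 => 1
  | i + 1 => (if ∃ w, InBlock w i ∧ c w = 1 then iter D y (fs i) else 1) * roundsEffect c i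

/-- The state of one copy after the rounds `0, …, i-1`. -/
def copyState (t i : ℕ) : Copy n k t → ℂ := fun s =>
  (roundsEffect D y fs s.1.2 i *ᵥ startAD n k) s.1.1 * (plusKet t s.1.2 * ket (0 : ZMod 2) s.2)

/-- For an active control the four gates compose to one iteration. For an inactive one Alice's two
uncontrolled `U_D(y)` cancel. -/
theorem copyState_succ (i : ℕ) :
    copyState D y fs t (i + 1) =
      (controlled t i (Gbar n k) * onAD t (UD D y)) *ᵥ
        (controlled t i (Uf n (fs i)) * onAD t (UD D y)) *ᵥ copyState D y fs t i := by
  have hout : ∀ (A : Matrix (AD n k) (AD n k) ℂ) (u : AD n k → ℂ) (z : ℂ),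
      (A *ᵥ fun a => u a * z) = fun a => (A *ᵥ u) a * z := by
    intro A u z
    ext a
    simp only [mulVec, dotProduct, Finset.sum_mul, mul_assoc]
  ext ⟨⟨a, c⟩, b⟩
  simp only [← mulVec_mulVec, controlled_mulVec, onAD_mulVec, copyState, hout, roundsEffect]
  congr 1
  split_ifs
  · simp only [iter, ← mulVec_mulVec]
  · simp only [one_mulVec]
    rw [mulVec_mulVec _ (UD D y) (UD D y), UD_mul_self, one_mulVec]

theorem initCopy_eq : initCopy n k t = copyState D y fs t 0 := by
  ext s
  simp only [initCopy, copyState, roundsEffect, one_mulVec, startAD]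
  ring

theorem stateAfter_eq (i : ℕ) :
    stateAfter t D y fs i = fun s => copyState D y fs t i s.1 * copyState D y fs t i s.2 := by
  induction i with
  | zero => simp only [stateAfter, initCopy_eq D y fs]
  | succ i ih =>
    rw [stateAfter, ih, groverRound]
    simp only [← mulVec_mulVec, onFst_mulVec, onSnd_mulVec]
    simp only [mulVec_mulVec]
    rw [copyState_succ]
    simp only [mulVec_mulVec, Matrix.mul_assoc]

/-- The blocks are disjoint because `2^{t-w} = 2 · 2^{t-w-1}`: each ends where the next begins. -/
theorem inBlock_iff {w : Fin t} {l : ℕ} (hl : l < 2 ^ (t - w.val - 1)) (v : Fin t) :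
    InBlock v (2 ^ t - 2 ^ (t - w.val) + 1 + l) ↔ v = w := by
  have hpow : ∀ w : Fin t, 2 ^ (t - w.val) = 2 * 2 ^ (t - w.val - 1) := by
    intro w
    rw [← pow_succ']; congr 1; omega
  have hle : ∀ w : Fin t, 2 ^ (t - w.val) ≤ 2 ^ t := fun w =>
    Nat.pow_le_pow_right two_pos (Nat.sub_le _ _)
  have hw := hpow w
  have hw' := hle w
  constructor
  · rintro ⟨h1, h2⟩
    by_contra hne
    rcases lt_or_gt_of_ne hne with h | h
    · have : 2 ^ (t - w.val) ≤ 2 ^ (t - v.val - 1) :=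
        Nat.pow_le_pow_right two_pos (by have : v.val < w.val := h; omega)
      omega
    · have : 2 ^ (t - v.val) ≤ 2 ^ (t - w.val - 1) :=
        Nat.pow_le_pow_right two_pos (by have : w.val < v.val := h; omega)
      omega
  · rintro rfl
    refine ⟨?_, ?_⟩ <;> omega

theorem roundsEffect_block (c : Bits t) (w : Fin t) (l : ℕ) (hl : l ≤ 2 ^ (t - w.val - 1)) :
    roundsEffect D y fs c (2 ^ t - 2 ^ (t - w.val) + 1 + l) =
      (if c w = 1 then effect D y (fun l => fs (2 ^ t - 2 ^ (t - w.val) + 1 + l)) l else 1) *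
        roundsEffect D y fs c (2 ^ t - 2 ^ (t - w.val) + 1) := by
  induction l with
  | zero => simp [effect]
  | succ l ih =>
    have hex : (∃ v, InBlock v (2 ^ t - 2 ^ (t - w.val) + 1 + l) ∧ c v = 1) ↔ c w = 1 := by
      simp only [inBlock_iff (Nat.lt_of_succ_le hl), exists_eq_left]
    rw [← Nat.add_assoc, roundsEffect, ih (Nat.le_of_succ_le hl), if_congr hex rfl rfl]
    split_ifs
    · rw [effect, Matrix.mul_assoc]
    · simp

/-- Each block contributes `Q` to the place value of its bit within `M`, or nothing if its qubit is
not in `M`. Induction over completed blocks adds these exponents, giving the binary value. -/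
theorem roundsEffect_eq_pow (Q : Matrix (AD n k) (AD n k) ℂ) (M : Finset (Fin t))
    (hQ : ∀ w, blockEffect D y fs w =
      if w ∈ M then Q ^ 2 ^ (M.filter (fun v => w < v)).card else 1) (c : Bits t) :
    roundsEffect D y fs c (2 ^ t) = Q ^ binVal M c := by
  have h : ∀ j ≤ t, roundsEffect D y fs c (2 ^ t - 2 ^ (t - j) + 1) =
      Q ^ ∑ w ∈ M.filter (fun w => w.val < j),
        (c w).val * 2 ^ (M.filter (fun v => w < v)).card := by
    intro j hj
    induction j with
    | zero =>
      -- The base case is one round, not zero: round 0 belongs to no control qubit and acts as the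
      -- identity.
      have h0 : ¬∃ w : Fin t, InBlock w 0 ∧ c w = 1 := by
        rintro ⟨w, ⟨h1, _⟩, _⟩
        exact absurd h1 (Nat.not_lt_zero _)
      simp only [Nat.sub_zero, Nat.sub_self, Nat.zero_add, Nat.not_lt_zero, Finset.filter_false,
        Finset.sum_empty, pow_zero]
      rw [roundsEffect, roundsEffect, if_neg h0, Matrix.one_mul]
    | succ j ih =>
      set w : Fin t := ⟨j, hj⟩ with hw
      have hpow : 2 ^ (t - w.val) = 2 * 2 ^ (t - w.val - 1) := by
        rw [← pow_succ']; congr 1; omega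
      have hle : 2 ^ (t - w.val) ≤ 2 ^ t := Nat.pow_le_pow_right two_pos (Nat.sub_le _ _)
      have hidx : 2 ^ t - 2 ^ (t - (j + 1)) + 1 =
          2 ^ t - 2 ^ (t - w.val) + 1 + 2 ^ (t - w.val - 1) := by
        have : t - (j + 1) = t - w.val - 1 := by simp only [hw]; omega
        rw [this]; omega
      have hb := hQ w
      rw [blockEffect] at hb
      rw [hidx, roundsEffect_block D y fs c w _ le_rfl, hb, ih (by omega)]
      by_cases hm : w ∈ M
      · have hf : M.filter (fun w => w.val < j + 1) =
            insert w (M.filter (fun w => w.val < j)) := by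
          ext x
          simp only [Finset.mem_filter, Finset.mem_insert, Fin.ext_iff, hw]
          constructor
          · rintro ⟨h1, h2⟩
            rcases Nat.lt_succ_iff_lt_or_eq.1 h2 with h3 | h3
            · exact Or.inr ⟨h1, h3⟩
            · exact Or.inl h3
          · rintro (h1 | ⟨h1, h2⟩)
            · refine ⟨?_, by omega⟩
              have : x = w := Fin.ext h1
              rwa [this]
            · exact ⟨h1, by omega⟩
        rw [hf, Finset.sum_insert (by simp [hw]), pow_add, if_pos hm]
        congr 1
        rcases zmod_two_cases (c w) with h | h <;> simp [h, ZMod.val_one]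
      · have hf : M.filter (fun w => w.val < j + 1) = M.filter (fun w => w.val < j) := by
          ext x
          simp only [Finset.mem_filter]
          refine and_congr_right fun hx => ?_
          have : x.val ≠ j := fun h => hm (by rwa [show w = x from Fin.ext h.symm])
          omega
        rw [hf, if_neg hm, ite_self, Matrix.one_mul]
  have := h t le_rfl
  have hp : 1 ≤ 2 ^ t := Nat.one_le_two_pow
  rw [Nat.sub_self, pow_zero, Nat.sub_add_cancel hp] at this
  rw [this, binVal]
  congr 2
  exact Finset.filter_true_of_mem fun w _ => w.isLt

theorem effect_eq_pow {f : Bits k → ZMod 2} {g : ℕ → Bits k → ZMod 2} {L : ℕ}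
    (h : ∀ l < L, g l = f) : effect D y g L = iter D y f ^ L := by
  induction L with
  | zero => rfl
  | succ L ih =>
    rw [effect, ih fun l hl => h l (by omega), h L (by omega), pow_succ']

theorem blockEffect_eq_pow {f : Bits k → ZMod 2} {w : Fin t}
    (h : ∀ i, InBlock w i → fs i = f) :
    blockEffect D y fs w = iter D y f ^ 2 ^ (t - w.val - 1) :=
  effect_eq_pow D y fun _ hl => h _ ((inBlock_iff hl w).2 rfl)

theorem card_filter_lt (w : Fin t) :
    (Finset.univ.filter fun v => w < v).card = t - w.val - 1 := by
  have : (Finset.univ.filter fun v => w < v) = Finset.Ioi w := by ext; simp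
  rw [this, Fin.card_Ioi]; omega

variable {D} {fs} in
/-- The rounds of a strategy apply the power of the Grover iteration that is encoded in the control
qubits to be measured. -/
theorem IsStrategy.roundsEffect_eq {f : Bits k → ZMod 2} {conf : Option (Fin t)}
    (h : IsStrategy D f fs conf) (c : Bits t) :
    roundsEffect D y fs c (2 ^ t) = iter D y f ^ binVal (readQubits conf) c := by
  refine roundsEffect_eq_pow D y fs _ _ (fun w => ?_) c
  cases conf with
  | none =>
    rw [readQubits, if_pos (Finset.mem_univ _), card_filter_lt]
    refine blockEffect_eq_pow D y fs fun i hi => h i ?_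
    have h1 := hi.2
    have h2 : 0 < 2 ^ (t - w.val - 1) := by positivity
    have h3 : 0 < 2 ^ t := by positivity
    omega
  | some u =>
    obtain ⟨hu, h1, h2, h3⟩ := h
    have herase : ((Finset.univ.erase u).filter fun v => w < v) =
        (Finset.univ.filter fun v => w < v).erase u := by
      rw [Finset.filter_erase]
    rw [readQubits, herase]
    -- Dropping `C_u` lowers the place value of each `w < u` by one power of two, matching the
    -- cancelled half of its rounds; place values for `w > u` are unchanged.
    rcases lt_trichotomy w u with hwu | rfl | hwu
    · rw [if_pos (by simp [hwu.ne]), Finset.card_erase_of_mem (by simp [hwu]), card_filter_lt,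
        h1 w hwu, Nat.sub_sub (t - w.val)]
    · rw [if_neg (by simp), h2]
    · rw [if_pos (by simp [hwu.ne']), Finset.erase_eq_of_notMem (by simp [hwu.le]), card_filter_lt,
        blockEffect_eq_pow D y fs (h3 w hwu)]

/-! ### The final state -/

theorem fourier_mulVec (M : Finset (Fin t)) (v : Copy n k t → ℂ) (a : AD n k) (c' : Bits t)
    (b : ZMod 2) :
    (fourier n k M *ᵥ v) ((a, c'), b) = ∑ c, qft M c' c * v ((a, c), b) := by
  simp only [fourier, mulVec, dotProduct, Fintype.sum_prod_type (α₁ := AD n k × Bits t),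
    kroneckerMap_apply, one_apply]
  rw [Fintype.sum_prod_type, Finset.sum_eq_single a]
  · refine Finset.sum_congr rfl fun c _ => ?_
    rw [Finset.sum_eq_single b]
    · simp
    · intro b' _ hb; simp [hb.symm]
    · simp
  · intro a' _ ha; simp [ha.symm]
  · simp

/-- The final state of one copy. -/
def copyFinal (f : Bits k → ZMod 2) (M : Finset (Fin t)) : Copy n k t → ℂ :=
  fourier n k M *ᵥ onAD t (UD D y) *ᵥ (Uf' n t f * onAD t (UD D y)) *ᵥ
    copyState D y fs t (2 ^ t)

theorem finalState_eq (f : Bits k → ZMod 2) (M : Finset (Fin t)) :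
    finalState D y f fs M = fun s => copyFinal D y fs f M s.1 * copyFinal D y fs f M s.2 := by
  unfold finalState copyFinal
  rw [stateAfter_eq]
  simp only [← mulVec_mulVec, onFst_mulVec, onSnd_mulVec]

/-- The two outer `U_D(y)` compute and uncompute the data, so `U'_f` merely writes a bit determined
by the address and data into the ancilla. Summing over the ancilla later gives a factor 1. -/
theorem copyFinal_apply (f : Bits k → ZMod 2) (M : Finset (Fin t)) (a : AD n k) (c' : Bits t)
    (b : ZMod 2) :
    copyFinal D y fs f M ((a, c'), b) = ket (0 : ZMod 2) (b + f (a.2 + D (a.1 + y))) *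
      ∑ c, qft M c' c * plusKet t c * (roundsEffect D y fs c (2 ^ t) *ᵥ startAD n k) a := by
  have hU : ∀ v : Copy n k t → ℂ, Uf' n t f *ᵥ v = fun s => v (s.1, s.2 + f s.1.1.2) := by
    intro v; ext s
    rw [Uf', permGate_mulVec (involutive_anc fun a : AD n k × Bits t => f a.1.2)]
  unfold copyFinal
  rw [fourier_mulVec, Finset.mul_sum]
  refine Finset.sum_congr rfl fun c _ => ?_
  rw [← mulVec_mulVec, onAD_mulVec, UD_mulVec, hU]
  simp only []
  rw [onAD_mulVec, UD_mulVec]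
  simp only [copyState, zmod_two_add_self_left]
  ring

theorem norm_phase (x : ℝ) (m : ℕ) : ‖Complex.exp (Complex.I * x) ^ m‖ = 1 := by
  rw [norm_pow, mul_comm, Complex.norm_exp_ofReal_mul_I, one_pow]

/-- The probability of an event for the outcome of the control measurement of one copy. -/
theorem sum_copyFinal {f : Bits k → ZMod 2} {conf : Option (Fin t)}
    (h : IsStrategy D f fs conf) (E : ℕ → Prop) [DecidablePred E] :
    ∑ s, (if E (binVal (readQubits conf) s.1.2) then
        ‖copyFinal D y fs f (readQubits conf) s‖ ^ 2 else 0) =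
      ((∑ θ ∈ Finset.range (2 ^ (readQubits conf).card), if E θ then
          ‖dirichlet (2 ^ (readQubits conf).card) (2 * Real.pi * θ /
            ((2 ^ (readQubits conf).card : ℕ) : ℝ) + (Real.pi + 2 * angle D f))‖ ^ 2 else 0) +
        ∑ θ ∈ Finset.range (2 ^ (readQubits conf).card), if E θ then
          ‖dirichlet (2 ^ (readQubits conf).card) (2 * Real.pi * θ /
            ((2 ^ (readQubits conf).card : ℕ) : ℝ) + (Real.pi + 2 * -angle D f))‖ ^ 2 else 0) / 2 := by
  set M := readQubits conf with hM
  set T := 2 ^ M.card with hT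
  have hTr : (T : ℝ) = 2 ^ M.card := by rw [hT]; push_cast; rfl
  have hT0 : 0 < T := by positivity
  have hsum : ∀ (a : AD n k) (c' : Bits t),
      ∑ c, qft M c' c * plusKet t c * (roundsEffect D y fs c (2 ^ t) *ᵥ startAD n k) a =
      ((√(2 ^ M.card : ℝ) : ℝ) : ℂ)⁻¹ * ((√(2 ^ t : ℝ) : ℝ) : ℂ)⁻¹ * ∑ m ∈ Finset.range T,
        Complex.exp (Complex.I * ((2 * Real.pi * binVal M c' / T : ℝ) : ℂ)) ^ m *
          (iter D y f ^ m *ᵥ startAD n k) a := by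
    intro a c'
    -- Bits outside `M` are fixed by the row of the Fourier transform, so the sum over `c` collapses
    -- to one over exponents `m < T`.
    rw [← sum_agree_binVal M _ c', Finset.mul_sum]
    refine Finset.sum_congr rfl fun c _ => ?_
    rw [h.roundsEffect_eq, ← hM, qft, of_apply, plusKet]
    split_ifs
    · rw [← Complex.exp_nat_mul]
      have : 2 * Real.pi * Complex.I * (binVal M c) * (binVal M c') / 2 ^ M.card =
          (binVal M c : ℂ) * (Complex.I * ((2 * Real.pi * binVal M c' / T : ℝ) : ℂ)) := by
        rw [hTr]; push_cast; ring
      rw [this]; ring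
    · simp
  have hb : ∀ (a : AD n k) (c' : Bits t),
      ∑ b, ‖copyFinal D y fs f M ((a, c'), b)‖ ^ 2 = (T : ℝ)⁻¹ * (2 ^ t)⁻¹ *
        ‖∑ m ∈ Finset.range T,
          Complex.exp (Complex.I * ((2 * Real.pi * binVal M c' / T : ℝ) : ℂ)) ^ m *
            (iter D y f ^ m *ᵥ startAD n k) a‖ ^ 2 := by
    intro a c'
    simp_rw [copyFinal_apply, hsum, norm_mul, mul_pow]
    rw [← Finset.sum_mul]
    have h1 : ∑ b, ‖ket (0 : ZMod 2) (b + f (a.2 + D (a.1 + y)))‖ ^ 2 = 1 := by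
      rcases zmod_two_cases (f (a.2 + D (a.1 + y))) with hz | hz <;> rw [hz, sum_zmod_two] <;>
        simp [ket, CharTwo.add_self_eq_zero]
    rw [h1, norm_inv, norm_inv, Complex.norm_real, Complex.norm_real, Real.norm_eq_abs,
      Real.norm_eq_abs, inv_pow, inv_pow, sq_abs, sq_abs, Real.sq_sqrt (by positivity),
      Real.sq_sqrt (by positivity), hTr, one_mul]
  have hc : ∀ c' : Bits t, ∑ a : AD n k, ∑ b, ‖copyFinal D y fs f M ((a, c'), b)‖ ^ 2 =
      T * (2 ^ t)⁻¹ * ((‖dirichlet T (2 * Real.pi * binVal M c' / T +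
          (Real.pi + 2 * angle D f))‖ ^ 2 +
        ‖dirichlet T (2 * Real.pi * binVal M c' / T + (Real.pi + 2 * -angle D f))‖ ^ 2) / 2) := by
    intro c'
    simp_rw [hb]
    rw [← Finset.mul_sum, sum_norm_phase_sum y hT0]
    have : (T : ℝ) ≠ 0 := by positivity
    field_simp
  rw [Fintype.sum_prod_type, Fintype.sum_prod_type, Finset.sum_comm]
  have hE : ∀ c' : Bits t, ∑ a : AD n k, ∑ b, (if E (binVal M c') then
      ‖copyFinal D y fs f M ((a, c'), b)‖ ^ 2 else 0) = if E (binVal M c') then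
      T * (2 ^ t)⁻¹ * ((‖dirichlet T (2 * Real.pi * binVal M c' / T +
          (Real.pi + 2 * angle D f))‖ ^ 2 +
        ‖dirichlet T (2 * Real.pi * binVal M c' / T + (Real.pi + 2 * -angle D f))‖ ^ 2) / 2)
      else 0 := by
    intro c'
    split_ifs
    · exact hc c'
    · simp
  simp only [hE]
  -- Each outcome `θ` arises from `2^t / T` bit strings, which cancels the weight `T / 2^t` of a
  -- single string.
  rw [sum_binVal M fun θ => if E θ then
      T * (2 ^ t)⁻¹ * ((‖dirichlet T (2 * Real.pi * θ / T + (Real.pi + 2 * angle D f))‖ ^ 2 +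
        ‖dirichlet T (2 * Real.pi * θ / T + (Real.pi + 2 * -angle D f))‖ ^ 2) / 2) else 0]
  rw [← hT, ← Finset.sum_add_distrib, Finset.sum_div, Finset.mul_sum]
  refine Finset.sum_congr rfl fun θ _ => ?_
  split_ifs
  · rw [← hTr]
    have : (T : ℝ) ≠ 0 := by positivity
    field_simp
  · simp

end rounds

/-! ### Accuracy of the estimate from one copy -/

section main

variable {n k t : ℕ} {D : Database n k} {f : Bits k → ZMod 2} {fs : ℕ → Bits k → ZMod 2}
  {conf : Option (Fin t)}

theorem sum_norm_copyFinal (h : IsStrategy D f fs conf) (y : Bits n) :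
    ∑ s, ‖copyFinal D y fs f (readQubits conf) s‖ ^ 2 = 1 := by
  have := sum_copyFinal D y fs h fun _ => True
  simp only [if_true] at this
  rw [this, sum_norm_dirichlet (by positivity), sum_norm_dirichlet (by positivity)]
  norm_num

open Classical in
/-- With probability at least `8 / π²`, the estimate from one copy has a small error. -/
theorem eight_div_pi_sq_le_sum_copyFinal (h : IsStrategy D f fs conf) (y : Bits n)
    (P : ℝ → Prop)
    (hP : ∀ v : ℝ, |v - frac D f| ≤ 2 * √(frac D f) * (Real.pi / 2 ^ (readQubits conf).card) +
      (Real.pi / 2 ^ (readQubits conf).card) ^ 2 → P v) :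
    8 / Real.pi ^ 2 ≤ ∑ s, if P (estimate (readQubits conf) s) then
      ‖copyFinal D y fs f (readQubits conf) s‖ ^ 2 else 0 := by
  have hsum := sum_copyFinal D y fs h
    fun θ => P (Real.cos (θ * Real.pi / 2 ^ (readQubits conf).card) ^ 2)
  refine le_of_le_of_eq ?_ (hsum.symm.trans
    (Finset.sum_congr rfl fun s _ => if_congr Iff.rfl rfl rfl))
  set M := readQubits conf with hM
  set T := 2 ^ M.card with hT
  have hTr : (T : ℝ) = 2 ^ M.card := by rw [hT]; push_cast; rfl
  -- The estimate depends only on `sin² ψ`, so the same event is good for both phases `ψ = ±φ`, and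
  -- the lower bound survives averaging.
  have key : ∀ ψ : ℝ, |Real.sin ψ| = √(frac D f) → 8 / Real.pi ^ 2 ≤
      ∑ θ ∈ Finset.range T, if P (Real.cos (θ * Real.pi / 2 ^ M.card) ^ 2) then
        ‖dirichlet T (2 * Real.pi * θ / T + (Real.pi + 2 * ψ))‖ ^ 2 else 0 := by
    intro ψ hψ
    refine eight_div_pi_sq_le_sum_dirichlet (by positivity) _ _ fun θ j hj => hP _ ?_
    have h1 : 2 * Real.pi * θ / T = 2 * (θ * Real.pi / 2 ^ M.card) := by rw [hTr]; ring
    have h2 : 2 * Real.pi / T = 2 * (Real.pi / 2 ^ M.card) := by rw [hTr]; ring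
    rw [h1, h2] at hj
    have := abs_cos_sq_sub_sin_sq_le hj
    rwa [hψ, ← sq_abs (Real.sin ψ), hψ, Real.sq_sqrt frac_nonneg] at this
  have h1 := key (angle D f) (by rw [sin_angle, abs_of_nonneg (Real.sqrt_nonneg _)])
  have h2 := key (-angle D f) (by
    rw [Real.sin_neg, abs_neg, sin_angle, abs_of_nonneg (Real.sqrt_nonneg _)])
  linarith

end main

/-! ### Success probability of the whole protocol -/

section protocol

variable {n k t : ℕ} [NeZero n] [NeZero k] {D : Database n k} {f : Bits k → ZMod 2}
  {fs : ℕ → Bits k → ZMod 2} {conf : Option (Fin t)}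

/-- Honest parties pass all tests, and each output on its own has a small error with probability
at least `8 / π²`. -/
theorem eight_div_pi_sq_le_protocolProb (p : ℝ) (h : IsStrategy D f fs conf) (P : ℝ → Prop)
    (hP : ∀ v : ℝ, |v - frac D f| ≤ 2 * √(frac D f) * (Real.pi / 2 ^ (readQubits conf).card) +
      (Real.pi / 2 ^ (readQubits conf).card) ^ 2 → P v) (i : Fin 2) :
    8 / Real.pi ^ 2 ≤ protocolProb p D f fs conf fun s => P (s i) := by
  classical
  unfold protocolProb
  simp only [passTest1_eq_one, passTest2_eq_one, survive_one, Finset.prod_const_one, one_mul]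
  have hy : ∀ y : Bits n, 8 / Real.pi ^ 2 ≤ ∑ s : Joint n k t,
      if P ((![estimate (readQubits conf) s.1, estimate (readQubits conf) s.2] : Fin 2 → ℝ) i)
        then ‖finalState D y f fs (readQubits conf) s‖ ^ 2 else 0 := by
    intro y
    refine (eight_div_pi_sq_le_sum_copyFinal h y P hP).trans_eq ?_
    simp only [finalState_eq, norm_mul, mul_pow]
    conv_rhs => rw [Fintype.sum_prod_type]
    -- The event concerns one copy only; the other is summed out of the product state with total
    -- weight 1.
    have hone := sum_norm_copyFinal h y
    fin_cases i
    · refine Finset.sum_congr rfl fun s _ => ?_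
      by_cases hs : P (estimate (readQubits conf) s)
      · rw [if_pos hs]
        refine Eq.trans ?_ (Finset.sum_congr rfl fun s' _ => (if_pos hs).symm)
        simp only []
        rw [← Finset.mul_sum, hone, mul_one]
      · rw [if_neg hs]
        exact (Finset.sum_eq_zero fun s' _ => if_neg hs).symm
    · conv_rhs => rw [Finset.sum_comm]
      refine Finset.sum_congr rfl fun s _ => ?_
      by_cases hs : P (estimate (readQubits conf) s)
      · rw [if_pos hs]
        refine Eq.trans ?_ (Finset.sum_congr rfl fun s' _ => (if_pos hs).symm)
        simp only []
        rw [← Finset.sum_mul, hone, one_mul]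
      · rw [if_neg hs]
        exact (Finset.sum_eq_zero fun s' _ => if_neg hs).symm
  have := Finset.card_nsmul_le_sum Finset.univ _ _ fun y _ => hy y
  rw [nsmul_eq_mul, Finset.card_univ] at this
  have hcard : (Fintype.card (Bits n) : ℝ) = 2 ^ n := by simp [ZMod.card]
  rw [hcard] at this
  rw [one_div_mul_eq_div, le_div_iff₀ (by positivity), mul_comm]
  exact this

end protocol

end

end QCount

open QCount
theorem mainTheorem4 (n k t : ℕ) [NeZero n] [NeZero k]
    (D : Database n k) (f : Bits k → ZMod 2)
    (fs : ℕ → Bits k → ZMod 2) (conf : Option (Fin t)) (hfs : IsStrategy D f fs conf)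
    (p : ℝ) (hp : p ∈ Set.Ioo (0 : ℝ) 1) (smin : ℝ) (hsmin : 0 < smin)
    (hT : conf = none → 100 / √smin < (2 : ℝ) ^ t)
    (hT' : conf ≠ none → 200 / √smin < (2 : ℝ) ^ t)
    (i : Fin 2) :
    8 / Real.pi ^ 2 ≤ protocolProb p D f fs conf (fun s =>
      (smin ≤ frac D f →
        |s i / frac D f - 1| <
          2 * Real.pi / 100 * √(smin / frac D f) + Real.pi ^ 2 / 10 ^ 4 * (smin / frac D f) ∧
        2 * Real.pi / 100 * √(smin / frac D f) + Real.pi ^ 2 / 10 ^ 4 * (smin / frac D f) < 0.07) ∧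
      (frac D f < smin →
        |s i - frac D f| / smin <
          2 * Real.pi / 100 * √(frac D f / smin) + Real.pi ^ 2 / 10 ^ 4 ∧
        2 * Real.pi / 100 * √(frac D f / smin) + Real.pi ^ 2 / 10 ^ 4 < 0.07)) ∧
    8 / Real.pi ^ 2 > 0.8 := by
  have hs : 0 < √smin := Real.sqrt_pos.2 hsmin
  -- A confusing qubit halves the number of outcomes, which is what the doubled constant 200 pays
  -- for.
  have hcard : 100 / √smin < 2 ^ (readQubits conf).card := by
    cases conf with
    | none => simpa [readQubits] using hT rfl
    | some u =>
      have ht : (Finset.univ.erase u).card = t - 1 := by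
        rw [Finset.card_erase_of_mem (Finset.mem_univ u), Finset.card_univ, Fintype.card_fin]
      have h2 := hT' (by simp)
      have h3 : (2 : ℝ) ^ t = 2 * 2 ^ (t - 1) := by
        rw [← pow_succ', Nat.sub_add_cancel u.pos]
      rw [readQubits, ht]
      have h4 : 200 / √smin = 2 * (100 / √smin) := by ring
      rw [h3, h4] at h2
      linarith
  refine ⟨eight_div_pi_sq_le_protocolProb p hfs (fun v =>
      (smin ≤ frac D f →
        |v / frac D f - 1| <
          2 * Real.pi / 100 * √(smin / frac D f) + Real.pi ^ 2 / 10 ^ 4 * (smin / frac D f) ∧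
        2 * Real.pi / 100 * √(smin / frac D f) + Real.pi ^ 2 / 10 ^ 4 * (smin / frac D f) < 0.07) ∧
      (frac D f < smin →
        |v - frac D f| / smin <
          2 * Real.pi / 100 * √(frac D f / smin) + Real.pi ^ 2 / 10 ^ 4 ∧
        2 * Real.pi / 100 * √(frac D f / smin) + Real.pi ^ 2 / 10 ^ 4 < 0.07))
    (fun v hv => ?_) i, ?_⟩
  · refine error_bounds frac_nonneg hsmin (by positivity) ?_ hv
    rw [div_lt_iff₀ hs] at hcard
    rw [div_lt_iff₀ (by positivity)]
    have := mul_lt_mul_of_pos_left hcard Real.pi_pos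
    linarith
  -- Since `π < 3.15`, one has `0.8 π² < 7.94 < 8`.
  · have h1 := Real.pi_lt_d2
    have h2 := Real.pi_gt_three
    rw [gt_iff_lt, lt_div_iff₀ (by positivity)]
    nlinarith
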